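/- Let $c,d\ge 0$ be integers and let $\mathcal G$ be an invertible hermitian $(c+d)\times(c+d)$ complex matrix with signature $(c,d)$, i.e. with $c$ positive and $d$ negative eigenvalues (counted with multiplicity). Let $\mathbb G=\{T\in \mathrm{Mat}(c+d,\mathbb C): T^*\mathcal G T=\mathcal G\}$ be the group of matrices leaving the form $v^*\mathcal G w$ invariant, and for $\theta\in[0,1]$ put $$U_\theta=\begin{pmatrix} e^{2\pi i\theta}\mathbf 1_c & 0\\ 0&\mathbf 1_d\end{pmatrix}.$$ Let $\sigma_1(T)\ge \sigma_2(T)\ge\dots\ge\sigma_{c+d}(T)$ denote the singular values of a matrix $T$, and for invertible $T$ put $N_d(T)=\sum_{i=1}^d \ln\frac{\sigma_i(T)+\sigma_i(T)^{-1}}{2}$. Given a probability space $(\mathbb X,\mathfrak A,\mu)$, a measure-preserving map $f:\mathbb X\to\mathbb X$ and a measurable map $A$ from $\mathbb X$ to the $(c+d)\times(c+d)$ matrices, write $A_n(x)=A(f^{n-1}(x))\cdots A(f(x))A(x)$ and $$L_k(f,A)=\lim_{n\to\infty}\frac1n\int_{\mathbb X}\ln \sigma_k(A_n(x))\,d\mu(x),\qquad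 L^d(f,A)=\sum_{k=1}^d L_k(f,A).$$ Then there is an invertible matrix $B$, depending only on $\mathcal G$, such that for every probability space $(\mathbb X,\mathfrak A,\mu)$, every measure-preserving map $f:\mathbb X\to\mathbb X$ and every measurable $A:\mathbb X\to\mathbb G$ with $\ln\|A(\cdot)\|\in L^1(\mu)$ the following holds: for every $\theta\in[0,1]$ the Lyapunov exponents $L_k(f,B^{-1}U_\theta BA)$, $1\le k\le d$, are well defined (the functions $\ln\sigma_k$ of all iterates are $\mu$-integrable and the limits exist in $\mathbb R$), the functions $\theta\mapsto L^d(f,B^{-1}U_\theta BA)$ and $x\mapsto N_d(BA(x)B^{-1})$ are integrable over $[0,1]$ and over $(\mathbb X,\mu)$, respectively, and $$\int_0^1 L^d(f,B^{-1}U_\theta B\,A)\,d\theta=\int_{\mathbb X}N_d(B\,A(x)\,B^{-1})\,d\mu(x).$$ -/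

import Mathlib

open MeasureTheory Filter Topology Matrix

namespace HermitianCocycle

variable {ι : Type*} [Fintype ι] [DecidableEq ι]

/-- The hermitian matrix `𝒢` has signature `(c, d)`: counted with multiplicity, it has exactly
`c` positive and exactly `d` negative eigenvalues. -/
def HasSignature (𝒢 : Matrix ι ι ℂ) (c d : ℕ) : Prop :=
  ∃ h : 𝒢.IsHermitian,
    Nat.card {i // 0 < h.eigenvalues i} = c ∧ Nat.card {i // h.eigenvalues i < 0} = d

/-- The group of all matrices `T` leaving the form `(v, w) ↦ v* 𝒢 w` invariant. -/
def formGroup (𝒢 : Matrix ι ι ℂ) : Set (Matrix ι ι ℂ) :=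
  {T | Tᴴ * 𝒢 * T = 𝒢}

/-- The block diagonal unitary matrix with blocks `e^{2πiθ} 1_c` and `1_d`. -/
noncomputable def blockRotation (c d : ℕ) (θ : ℝ) : Matrix (Fin c ⊕ Fin d) (Fin c ⊕ Fin d) ℂ :=
  Matrix.fromBlocks (Complex.exp (2 * Real.pi * Complex.I * θ) • 1) 0 0 1

/-- The singular values of a square matrix in decreasing order, counted with multiplicity.
The index starts at `0`, so that `singularValue T k` is `σ_{k+1}(T)`. -/
noncomputable def singularValue (T : Matrix ι ι ℂ) (k : ℕ) : ℝ :=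
  (Matrix.toEuclideanLin T).singularValues k

/-- `N_r(T) = ∑_{i=1}^r ln ((σ_i(T) + σ_i(T)⁻¹) / 2)`. -/
noncomputable def logCoshSum (r : ℕ) (T : Matrix ι ι ℂ) : ℝ :=
  ∑ i ∈ Finset.range r, Real.log ((singularValue T i + (singularValue T i)⁻¹) / 2)

variable {X : Type*}

/-- The iterates `A_n(x) = A(f^{n-1}(x)) ⋯ A(f(x)) A(x)`, with `A_0(x) = 1`. -/
def cocycleIterate (f : X → X) (A : X → Matrix ι ι ℂ) : ℕ → X → Matrix ι ι ℂ
  | 0, _ => 1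
  | n + 1, x => A (f^[n] x) * cocycleIterate f A n x

variable [MeasurableSpace X]

/-- `A` is a measurable map into `𝔾` (measurability being that of all matrix entries) for which
`x ↦ ln ‖A(x)‖` is `μ`-integrable, where `‖·‖` is the operator norm for the Euclidean norm. -/
structure LogIntegrable (μ : Measure X) (𝔾 : Set (Matrix ι ι ℂ)) (A : X → Matrix ι ι ℂ) :
    Prop where
  mem : ∀ x, A x ∈ 𝔾
  measurable : ∀ i j, Measurable fun x => A x i j
  integrable_log_norm :
    Integrable (fun x => Real.log ‖Matrix.toEuclideanCLM (n := ι) (𝕜 := ℂ) (A x)‖) μ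

/-- `(1/n) ∫ ln σ_{k+1}(A_n(x)) dμ(x)`. -/
noncomputable def meanLogSingularValue (μ : Measure X) (f : X → X) (A : X → Matrix ι ι ℂ)
    (k n : ℕ) : ℝ :=
  (1 / (n : ℝ)) * ∫ x, Real.log (singularValue (cocycleIterate f A n x) k) ∂μ

/-- The Lyapunov exponent `L_{k+1}(f, A) = lim_n (1/n) ∫ ln σ_{k+1}(A_n(x)) dμ(x)`;
see `LyapunovExponentExists` for its existence. -/
noncomputable def lyapunovExponent (μ : Measure X) (f : X → X) (A : X → Matrix ι ι ℂ)
    (k : ℕ) : ℝ :=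
  limUnder atTop (meanLogSingularValue μ f A k)

/-- The Lyapunov exponent `L_{k+1}(f, A)` is well defined: all the integrals in its definition
exist and the limit exists. -/
def LyapunovExponentExists (μ : Measure X) (f : X → X) (A : X → Matrix ι ι ℂ) (k : ℕ) : Prop :=
  (∀ n, Integrable (fun x => Real.log (singularValue (cocycleIterate f A n x) k)) μ) ∧
    ∃ L : ℝ, Tendsto (meanLogSingularValue μ f A k) atTop (𝓝 L)

/-- `L^r(f, A) = L_1(f, A) + ⋯ + L_r(f, A)`. -/
noncomputable def lyapunovSum (μ : Measure X) (f : X → X) (A : X → Matrix ι ι ℂ) (r : ℕ) : ℝ :=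
  ∑ k ∈ Finset.range r, lyapunovExponent μ f A k

end HermitianCocycle

open HermitianCocycle

/-! By Sylvester's law of inertia 𝒢 = B* J B with J = diag(1_c, -1_d), so conjugation by B carries
the problem to the group of J. For T in that group let D be its lower right d × d block. The key
identity is N_d(T) = ln |det D| (`logCoshSum_eq_log_norm_det`). Since (T*T)⁻¹ = J T*T J, the matrix
(T*T + (T*T)⁻¹ + 2)/4 is block diagonal, and comparing determinants gives the identity once two
facts are known: the singular values are symmetric under σ ↦ σ⁻¹, and those at the positions between
min(c, d) and max(c, d) equal 1.

Now replace e^{2πiθ} by a complex z. The determinant of the lower right block of the n-th iterate is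
entire in z. It has no zero for |z| ≤ 1, because diag(z 1_c, 1_d) does not increase the form of J
there. At z = 0 the iterate is block lower triangular and the determinant factors along the orbit.
The mean value property of ln |·| therefore gives an exact formula for every n: averaging over θ
turns ln |det D_n| into ∑_{k<n} N_d(A(f^k x)) (`integral_log_norm_det_cocycleIterate`). Fubini and
the invariance of μ turn the normalized double integral into ∫ N_d, for every n ≥ 1.

Finally N_d differs from the sum of the d largest ln σ_i by at most d ln 2, and conjugation by B
costs another bounded error. Both vanish after division by n, so the normalized integrals converge
to L^d for each θ; dominated convergence in θ concludes. The limits exist by Fekete's lemma, because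
the product of the k largest singular values is submultiplicative (`prodSq_mul_le`). -/

namespace HermitianCocycle

/-! ### Products of the largest singular values through Gram determinants -/

section SingularValues

variable {ι : Type*} [Fintype ι]

/-- Cauchy–Binet, summed over all maps instead of k-subsets: non-injective maps contribute 0 and
each subset is counted k! times, so ι needs no order. Reindexing f by each permutation τ and summing
over τ assembles the determinant of the second factor. -/
theorem factorial_smul_det_mul {R : Type*} [CommRing R] {k : ℕ} (A : Matrix (Fin k) ι R)
    (B : Matrix ι (Fin k) R) :
    (k.factorial : R) * (A * B).det =
      ∑ f : Fin k → ι, (A.submatrix id f).det * (B.submatrix f id).det := by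
  have h1 : (A * B).det = ∑ f : Fin k → ι, (A.submatrix id f).det * ∏ i, B (f i) i := by
    simp only [det_apply', mul_apply, Finset.prod_univ_sum, Finset.mul_sum, Fintype.piFinset_univ]
    rw [Finset.sum_comm]
    refine Finset.sum_congr rfl fun f _ => ?_
    rw [Finset.sum_mul]
    refine Finset.sum_congr rfl fun σ _ => ?_
    simp [Finset.prod_mul_distrib, mul_assoc]
  have h2 : ∀ τ : Equiv.Perm (Fin k), (A * B).det = ∑ f : Fin k → ι,
      (A.submatrix id f).det * ((Equiv.Perm.sign τ : ℤ) * ∏ i, B (f (τ i)) i) := by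
    intro τ
    rw [h1, ← (Equiv.arrowCongr τ.symm (Equiv.refl ι)).sum_comp]
    refine Finset.sum_congr rfl fun f _ => ?_
    have : A.submatrix id ((Equiv.arrowCongr τ.symm (Equiv.refl ι)) f)
        = (A.submatrix id f).submatrix id τ := by
      ext; simp
    rw [this, det_permute']
    simp
    ring
  have h3 : (k.factorial : R) * (A * B).det = ∑ _τ : Equiv.Perm (Fin k), (A * B).det := by
    simp [Fintype.card_perm]
  rw [h3, Finset.sum_congr rfl fun τ _ => h2 τ, Finset.sum_comm]
  refine Finset.sum_congr rfl fun f _ => ?_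
  rw [← Finset.mul_sum]
  congr 1
  rw [det_apply']
  rfl

theorem isCompact_orthonormal_frames (k : ℕ) :
    IsCompact {W : Matrix ι (Fin k) ℂ | Wᴴ * W = 1} := by
  refine IsCompact.of_isClosed_subset
    (isCompact_univ_pi fun _ : ι => isCompact_univ_pi fun _ : Fin k =>
      isCompact_closedBall (0 : ℂ) 1) ?_ ?_
  · exact isClosed_eq (by fun_prop) continuous_const
  · intro W hW i _ j _
    have h := congrArg Complex.re (congrFun (congrFun hW j) j)
    simp only [mul_apply, conjTranspose_apply, one_apply_eq, Complex.one_re, Complex.re_sum,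
      Complex.star_def, ← Complex.normSq_eq_conj_mul_self, Complex.ofReal_re] at h
    have h2 : Complex.normSq (W i j) ≤ 1 := by
      rw [← h]
      exact Finset.single_le_sum (f := fun i => Complex.normSq (W i j))
        (fun _ _ => Complex.normSq_nonneg _) (Finset.mem_univ i)
    rw [mem_closedBall_zero_iff]
    rw [Complex.normSq_eq_norm_sq] at h2
    exact (sq_le_one_iff₀ (norm_nonneg _)).1 h2

variable [DecidableEq ι]

theorem singularValue_nonneg (T : Matrix ι ι ℂ) (k : ℕ) : 0 ≤ singularValue T k :=
  LinearMap.singularValues_nonneg _ k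

theorem singularValue_antitone (T : Matrix ι ι ℂ) : Antitone (singularValue T) :=
  LinearMap.singularValues_antitone _

theorem eigenvalues_congr {E : Type*} [NormedAddCommGroup E] [InnerProductSpace ℂ E]
    [FiniteDimensional ℂ E] {n : ℕ} {S T : E →ₗ[ℂ] E} (h : S = T) (hS : S.IsSymmetric)
    (hT : T.IsSymmetric) (hn : Module.finrank ℂ E = n) : hS.eigenvalues hn = hT.eigenvalues hn := by
  subst h; rfl

theorem eigenvalues₀_conjTranspose_mul_self (T : Matrix ι ι ℂ) (i : Fin (Fintype.card ι)) :
    (isHermitian_conjTranspose_mul_self T).eigenvalues₀ i = singularValue T i ^ 2 := by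
  unfold singularValue
  rw [LinearMap.sq_singularValues_fin (toEuclideanLin T) (finrank_euclideanSpace (𝕜 := ℂ) (ι := ι)) i]
  unfold IsHermitian.eigenvalues₀
  refine congrFun (eigenvalues_congr ?_ _ _ _) i
  rw [← toEuclideanLin_conjTranspose_eq_adjoint, toLpLin_mul]

theorem exists_unitary_diagonal (T : Matrix ι ι ℂ) :
    ∃ (e : ι ≃ Fin (Fintype.card ι)) (U : Matrix ι ι ℂ), Uᴴ * U = 1 ∧ U * Uᴴ = 1 ∧
      Tᴴ * T = U * diagonal (fun i => ((singularValue T (e i) ^ 2 : ℝ) : ℂ)) * Uᴴ := by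
  have hH := isHermitian_conjTranspose_mul_self T
  refine ⟨(Fintype.equivOfCardEq (Fintype.card_fin _)).symm, hH.eigenvectorUnitary,
    (Unitary.mem_iff.1 hH.eigenvectorUnitary.2).1, (Unitary.mem_iff.1 hH.eigenvectorUnitary.2).2, ?_⟩
  conv_lhs => rw [hH.spectral_theorem, Unitary.conjStarAlgAut_apply]
  congr 3
  ext i
  simp only [Function.comp, IsHermitian.eigenvalues, eigenvalues₀_conjTranspose_mul_self]
  rfl

theorem prod_le_prod_range_of_injective {s : ℕ → ℝ} (hs : Antitone s) (h0 : ∀ i, 0 ≤ s i) {k : ℕ}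
    {g : Fin k → ℕ} (hg : Function.Injective g) :
    ∏ i, s (g i) ≤ ∏ i ∈ Finset.range k, s i := by
  have hc : (Finset.univ.image g).card = k := by
    rw [Finset.card_image_of_injective _ hg, Finset.card_univ, Fintype.card_fin]
  have h1 : ∏ i, s (g i) = ∏ j ∈ Finset.univ.image g, s j := by
    rw [Finset.prod_image fun a _ b _ h => hg h]
  set S := Finset.univ.image g
  have h2 : ∏ j ∈ S, s j = ∏ i : Fin k, s (S.orderEmbOfFin hc i) := by
    conv_lhs => rw [← Finset.map_orderEmbOfFin_univ S hc]
    rw [Finset.prod_map]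
    rfl
  rw [h1, h2, ← Fin.prod_univ_eq_prod_range]
  refine Finset.prod_le_prod (fun i _ => h0 _) fun i _ => hs ?_
  -- In a strictly increasing list of naturals the m-th entry is at least m, so antitonicity
  -- compares the products factor by factor.
  have hm := (S.orderEmbOfFin hc).strictMono
  have : ∀ m (hm' : m < k), m ≤ S.orderEmbOfFin hc ⟨m, hm'⟩ := by
    intro m
    induction m with
    | zero => intro _; exact Nat.zero_le _
    | succ m ih =>
      intro hlt
      exact Nat.succ_le_of_lt ((ih (by omega)).trans_lt (hm (Fin.mk_lt_mk.2 (Nat.lt_succ_self m))))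
  exact this i i.2

/-- The product of the squares of the `k` largest singular values. -/
noncomputable def prodSq (k : ℕ) (T : Matrix ι ι ℂ) : ℝ :=
  ∏ i ∈ Finset.range k, singularValue T i ^ 2

theorem prodSq_nonneg (k : ℕ) (T : Matrix ι ι ℂ) : 0 ≤ prodSq k T :=
  Finset.prod_nonneg fun _ _ => sq_nonneg _

theorem factorial_mul_det_gram_diagonal {k : ℕ} (s : ι → ℝ) (W : Matrix ι (Fin k) ℂ) :
    (k.factorial : ℝ) * (Wᴴ * diagonal (fun i => (s i : ℂ)) * W).det.re =
      ∑ f : Fin k → ι, (∏ i, s (f i)) * ‖(W.submatrix f id).det‖ ^ 2 := by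
  have h := factorial_smul_det_mul (Wᴴ * diagonal (fun i => (s i : ℂ))) W
  have h' := congrArg Complex.re h
  rw [Complex.re_sum, ← Complex.ofReal_natCast, Complex.re_ofReal_mul] at h'
  rw [h']
  refine Finset.sum_congr rfl fun f _ => ?_
  have : (Wᴴ * diagonal (fun i => (s i : ℂ))).submatrix id f
      = (W.submatrix f id)ᴴ * diagonal (fun i => (s (f i) : ℂ)) := by
    ext i j; simp [mul_diagonal]
  rw [this, det_mul, det_diagonal, det_conjTranspose, mul_right_comm, Complex.star_def,
    mul_comm, ← Complex.normSq_eq_conj_mul_self, ← Complex.ofReal_prod, Complex.normSq_eq_norm_sq]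
  norm_cast

/-- Half of the variational principle for `prodSq`, replacing exterior powers. In an eigenbasis of
T*T both Gram determinants become sums of squared minors by Cauchy–Binet, and each weight is a
product of k distinct σ², hence at most the product of the k largest. -/
theorem det_gram_le {k : ℕ} (T : Matrix ι ι ℂ) (W : Matrix ι (Fin k) ℂ) :
    (Wᴴ * (Tᴴ * T) * W).det.re ≤ prodSq k T * (Wᴴ * W).det.re := by
  obtain ⟨e, U, hU, hU', hT⟩ := exists_unitary_diagonal T
  have h1 : Wᴴ * (Tᴴ * T) * W = (Uᴴ * W)ᴴ *
      diagonal (fun i => ((singularValue T (e i) ^ 2 : ℝ) : ℂ)) * (Uᴴ * W) := by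
    rw [hT, conjTranspose_mul, conjTranspose_conjTranspose]; simp only [Matrix.mul_assoc]
  have h2 : Wᴴ * W = (Uᴴ * W)ᴴ * (diagonal (fun _ => ((1 : ℝ) : ℂ)) : Matrix ι ι ℂ) * (Uᴴ * W) := by
    rw [conjTranspose_mul, conjTranspose_conjTranspose, Complex.ofReal_one, diagonal_one,
      Matrix.mul_one, Matrix.mul_assoc, ← Matrix.mul_assoc U, hU', Matrix.one_mul]
  have hk : (0 : ℝ) < k.factorial := by exact_mod_cast k.factorial_pos
  refine le_of_mul_le_mul_left ?_ hk
  rw [mul_left_comm, h1, h2, factorial_mul_det_gram_diagonal, factorial_mul_det_gram_diagonal,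
    Finset.mul_sum]
  refine Finset.sum_le_sum fun f _ => ?_
  rw [Finset.prod_const_one, one_mul]
  by_cases hf : Function.Injective f
  · refine mul_le_mul_of_nonneg_right ?_ (sq_nonneg _)
    exact prod_le_prod_range_of_injective (s := fun i => singularValue T i ^ 2)
      (fun a b h => pow_le_pow_left₀ (singularValue_nonneg _ _) (singularValue_antitone T h) 2)
      (fun _ => sq_nonneg _) (g := fun i => (e (f i) : ℕ))
      (Fin.val_injective.comp (e.injective.comp hf))
  -- A repeated row kills the minor, so the weight needs no bound here.
  · obtain ⟨i, j, hij, hne⟩ : ∃ i j, f i = f j ∧ i ≠ j := by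
      simpa [Function.Injective] using hf
    rw [det_zero_of_row_eq hne (by ext; simp [hij])]
    simp

/-- The maximum is attained at the frame of eigenvectors for the k largest eigenvalues of T*T. -/
theorem exists_det_gram_eq {k : ℕ} (T : Matrix ι ι ℂ) (hk : k ≤ Fintype.card ι) :
    ∃ W : Matrix ι (Fin k) ℂ, Wᴴ * W = 1 ∧ (Wᴴ * (Tᴴ * T) * W).det.re = prodSq k T := by
  obtain ⟨e, U, hU, hU', hT⟩ := exists_unitary_diagonal T
  let g : Fin k → ι := fun i => e.symm (Fin.castLE hk i)
  have hg : Function.Injective g := e.symm.injective.comp (Fin.castLE_injective hk)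
  let Q : Matrix ι (Fin k) ℂ := (1 : Matrix ι ι ℂ).submatrix id g
  have hQ : ∀ M : Matrix ι ι ℂ, Qᴴ * M * Q = M.submatrix g g := by
    intro M
    simp only [Q, conjTranspose_submatrix, conjTranspose_one]
    ext i j
    simp [mul_apply, one_apply]
  have hU2 : (U * Q)ᴴ = Qᴴ * Uᴴ := conjTranspose_mul _ _
  refine ⟨U * Q, ?_, ?_⟩
  · rw [hU2, Matrix.mul_assoc, ← Matrix.mul_assoc Uᴴ, hU, ← Matrix.mul_assoc, hQ]
    exact submatrix_one g hg
  · have : (U * Q)ᴴ * (Tᴴ * T) * (U * Q) =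
        Qᴴ * diagonal (fun i => ((singularValue T (e i) ^ 2 : ℝ) : ℂ)) * Q := by
      rw [hU2, hT]
      calc _ = Qᴴ * (Uᴴ * U) * diagonal (fun i => ((singularValue T (e i) ^ 2 : ℝ) : ℂ))
              * (Uᴴ * U) * Q := by simp only [Matrix.mul_assoc]
        _ = _ := by rw [hU, Matrix.mul_one, Matrix.mul_one]
    rw [this, hQ, submatrix_diagonal _ _ hg, det_diagonal, prodSq, ← Fin.prod_univ_eq_prod_range]
    simp only [Function.comp, g, Equiv.apply_symm_apply, Fin.val_castLE, ← Complex.ofReal_prod,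
      Complex.ofReal_re]

/-- Take a maximizing frame W for ST, then bound with S on the frame TW and with T on W. -/
theorem prodSq_mul_le {k : ℕ} (hk : k ≤ Fintype.card ι) (S T : Matrix ι ι ℂ) :
    prodSq k (S * T) ≤ prodSq k S * prodSq k T := by
  obtain ⟨W, hW, hST⟩ := exists_det_gram_eq (S * T) hk
  have h1 := det_gram_le S (T * W)
  have h2 := det_gram_le T W
  rw [hW, det_one, Complex.one_re, mul_one] at h2
  rw [conjTranspose_mul] at h1 hST
  calc prodSq k (S * T) = (Wᴴ * Tᴴ * (Sᴴ * S) * (T * W)).det.re := by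
        rw [← hST]; simp only [Matrix.mul_assoc]
    _ ≤ prodSq k S * (Wᴴ * Tᴴ * (T * W)).det.re := h1
    _ = prodSq k S * (Wᴴ * (Tᴴ * T) * W).det.re := by simp only [Matrix.mul_assoc]
    _ ≤ _ := mul_le_mul_of_nonneg_left h2 (prodSq_nonneg _ _)

/-- A supremum of jointly continuous functions over the compact set of orthonormal frames is
continuous. This is the source of measurability for the singular values of a cocycle. -/
theorem continuous_prodSq {k : ℕ} (hk : k ≤ Fintype.card ι) :
    Continuous (prodSq k : Matrix ι ι ℂ → ℝ) := by
  have h := (isCompact_orthonormal_frames (ι := ι) k).continuous_sSup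
    (f := fun (T : Matrix ι ι ℂ) (W : Matrix ι (Fin k) ℂ) => (Wᴴ * (Tᴴ * T) * W).det.re)
    (Complex.continuous_re.comp (Continuous.matrix_det (by fun_prop)))
  convert h using 2 with T
  symm
  refine IsGreatest.csSup_eq ⟨?_, ?_⟩
  · obtain ⟨W, hW, h⟩ := exists_det_gram_eq T hk
    exact ⟨W, hW, h⟩
  · rintro _ ⟨W, hW, rfl⟩
    have := det_gram_le T W
    rwa [show Wᴴ * W = 1 from hW, det_one, Complex.one_re, mul_one] at this

theorem prodSq_card (T : Matrix ι ι ℂ) : prodSq (Fintype.card ι) T = ‖T.det‖ ^ 2 := by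
  obtain ⟨e, U, hU, hU', hT⟩ := exists_unitary_diagonal T
  have h := congrArg det hT
  rw [det_mul, det_mul_right_comm, hU', Matrix.one_mul, det_diagonal, det_conjTranspose,
    Complex.star_def, ← Complex.normSq_eq_conj_mul_self, ← Complex.ofReal_prod,
    Complex.ofReal_inj, Complex.normSq_eq_norm_sq,
    e.prod_comp (fun i => singularValue T i ^ 2)] at h
  rw [h, prodSq, ← Fin.prod_univ_eq_prod_range]

theorem singularValue_le_norm (T : Matrix ι ι ℂ) (k : ℕ) :
    singularValue T k ≤ ‖Matrix.toEuclideanCLM (n := ι) (𝕜 := ℂ) T‖ := by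
  by_cases hk : k < Module.finrank ℂ (EuclideanSpace ℂ ι)
  · obtain ⟨v, hv⟩ := (LinearMap.hasEigenvalue_adjoint_comp_self_sq_singularValues
      (Matrix.toEuclideanLin T) hk).exists_hasEigenvector
    have h1 := hv.apply_eq_smul
    have h0 : 0 < ‖v‖ := norm_pos_iff.2 hv.2
    have h2 : ‖Matrix.toEuclideanLin T v‖ ^ 2 = (singularValue T k * ‖v‖) ^ 2 := by
      have := congrArg (fun w => inner ℂ v w) h1
      simp only [LinearMap.comp_apply, LinearMap.adjoint_inner_right, inner_smul_right,
        inner_self_eq_norm_sq_to_K] at this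
      rw [mul_pow]
      unfold singularValue
      exact_mod_cast this
    have h3 : ‖Matrix.toEuclideanLin T v‖ = singularValue T k * ‖v‖ := by
      rwa [pow_left_inj₀ (norm_nonneg _) (mul_nonneg (singularValue_nonneg _ _) h0.le)
        two_ne_zero] at h2
    refine le_of_mul_le_mul_right ?_ h0
    rw [← h3]
    exact (Matrix.toEuclideanCLM (n := ι) (𝕜 := ℂ) T).le_opNorm v
  -- Beyond the dimension the singular values are 0 by convention.
  · unfold singularValue
    rw [LinearMap.singularValues_of_finrank_le _ (not_lt.1 hk)]
    exact norm_nonneg _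

end SingularValues

/-! ### Singular values and blocks of matrices preserving diag(1_c, -1_d) -/

section PseudoUnitary

theorem antitone_eq_of_map_eq {n : ℕ} {f g : Fin n → ℝ} (hf : Antitone f) (hg : Antitone g)
    (h : Finset.univ.val.map f = Finset.univ.val.map g) : f = g := by
  refine List.ofFn_injective (List.Perm.eq_of_sortedGE hf.sortedGE_ofFn hg.sortedGE_ofFn ?_)
  rw [List.ofFn_eq_map, List.ofFn_eq_map, ← Multiset.coe_eq_coe]
  simpa [Fin.univ_val_map, List.ofFn_eq_map] using h

theorem charpoly_conj_diagonal {ι : Type*} [Fintype ι] [DecidableEq ι] {U V : Matrix ι ι ℂ}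
    (h : V * U = 1) (f : ι → ℂ) :
    (U * diagonal f * V).charpoly =
      ((Finset.univ.val.map f).map fun a => Polynomial.X - Polynomial.C a).prod := by
  rw [charpoly_mul_comm, ← Matrix.mul_assoc, h, Matrix.one_mul, charpoly_diagonal,
    Multiset.map_map]
  rfl

/-- The last d factors mirror the first d. The products of the first c and of the first d factors
agree because they differ only by factors at positions in [min, max), all equal to 1. -/
theorem prod_range_eq_sq_of_reflect {c d : ℕ} {p : ℕ → ℝ}
    (hr : ∀ i < c + d, p (c + d - 1 - i) = p i) (h1 : ∀ i, min c d ≤ i → i < max c d → p i = 1) :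
    ∏ i ∈ Finset.range (c + d), p i = (∏ i ∈ Finset.range d, p i) ^ 2 := by
  rw [Finset.prod_range_add]
  have e1 : ∏ i ∈ Finset.range d, p (c + i) = ∏ i ∈ Finset.range d, p i := by
    rw [← Finset.prod_range_reflect]
    refine Finset.prod_congr rfl fun i hi => ?_
    have := Finset.mem_range.1 hi
    rw [← hr i (by omega)]
    congr 1
    omega
  have e2 : ∀ a, min c d ≤ a → a ≤ max c d →
      ∏ i ∈ Finset.range a, p i = ∏ i ∈ Finset.range (min c d), p i := by
    intro a ha ha'
    symm
    refine Finset.prod_subset (Finset.range_subset_range.2 ha) fun i hi hi' => ?_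
    simp only [Finset.mem_range, not_lt] at hi hi'
    exact h1 i hi' (hi.trans_le ha')
  rw [e1, e2 c (min_le_left _ _) (le_max_left _ _), e2 d (min_le_right _ _) (le_max_right _ _), sq]

/-- If s i > 1 at a middle position, then s 0, …, s i exceed 1 and their mirror images are below 1.
These are 2(i + 1) > 2 min(c, d) values different from 1, too many. The mirror of a middle position
is again a middle position, which excludes s i < 1. -/
theorem eq_one_of_reflect {c d : ℕ} {s : ℕ → ℝ} (hs : Antitone s) (hpos : ∀ i < c + d, 0 < s i)
    (hr : ∀ i < c + d, s i * s (c + d - 1 - i) = 1)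
    (hcard : ((Finset.range (c + d)).filter fun i => s i ≠ 1).card ≤ 2 * min c d) (i : ℕ)
    (hi : min c d ≤ i) (hi' : i < max c d) : s i = 1 := by
  have key : ∀ i, min c d ≤ i → i < max c d → ¬ 1 < s i := by
    intro i hi hi' h
    have hlt : i < c + d := by omega
    have h2 : s (c + d - 1 - i) < 1 := by
      by_contra hcon
      push Not at hcon
      have := hr i hlt
      nlinarith
    -- This separates the initial segment from its mirror image, so that their cardinalities add.
    have hii : i < c + d - 1 - i := by
      by_contra hcon
      have := hs (not_lt.1 hcon)
      linarith
    have hsub : Finset.range (i + 1) ∪ (Finset.range (i + 1)).image (fun j => c + d - 1 - j) ⊆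
        (Finset.range (c + d)).filter fun i => s i ≠ 1 := by
      intro j hj
      simp only [Finset.mem_union, Finset.mem_image, Finset.mem_range, Finset.mem_filter] at hj ⊢
      rcases hj with hj | ⟨l, hl, rfl⟩
      · exact ⟨by omega, (h.trans_le (hs (by omega))).ne'⟩
      · exact ⟨by omega, ((hs (by omega : c + d - 1 - i ≤ c + d - 1 - l)).trans_lt h2).ne⟩
    have hc := Finset.card_le_card hsub
    rw [Finset.card_union_of_disjoint, Finset.card_image_of_injOn, Finset.card_range] at hc
    · omega
    · intro a ha b hb hab
      simp only [Finset.coe_range, Set.mem_Iio] at ha hb hab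
      omega
    · rw [Finset.disjoint_left]
      intro a ha hb
      simp only [Finset.mem_image, Finset.mem_range] at ha hb
      obtain ⟨l, hl, rfl⟩ := hb
      omega
  have hlt : i < c + d := by omega
  refine le_antisymm (not_lt.1 (key i hi hi')) ?_
  have h2 := not_lt.1 (key (c + d - 1 - i) (by omega) (by omega))
  have := hr i hlt
  nlinarith [hpos i hlt]

variable {c d : ℕ}

/-- The standard hermitian form of signature `(c, d)`. -/
def signMatrix (c d : ℕ) : Matrix (Fin c ⊕ Fin d) (Fin c ⊕ Fin d) ℂ := fromBlocks 1 0 0 (-1)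

theorem signMatrix_mul_self : signMatrix c d * signMatrix c d = 1 := by
  simp [signMatrix, fromBlocks_multiply]

theorem mul_sign_conjTranspose {T : Matrix (Fin c ⊕ Fin d) (Fin c ⊕ Fin d) ℂ}
    (hT : T ∈ formGroup (signMatrix c d)) : T * signMatrix c d * Tᴴ = signMatrix c d := by
  have h : Tᴴ * signMatrix c d * T = signMatrix c d := hT
  have h1 : (signMatrix c d * Tᴴ * signMatrix c d) * T = 1 := by
    rw [Matrix.mul_assoc, Matrix.mul_assoc, ← Matrix.mul_assoc Tᴴ, h, signMatrix_mul_self]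
  have h2 := mul_eq_one_comm.1 h1
  calc T * signMatrix c d * Tᴴ
      = T * (signMatrix c d * Tᴴ * signMatrix c d) * signMatrix c d := by
        simp only [Matrix.mul_assoc, signMatrix_mul_self, Matrix.mul_one]
    _ = _ := by rw [h2, Matrix.one_mul]

/-- The group is closed under adjoints, so T J T* = J collapses the middle of the product. -/
theorem gram_mul_sign_gram {T : Matrix (Fin c ⊕ Fin d) (Fin c ⊕ Fin d) ℂ}
    (hT : T ∈ formGroup (signMatrix c d)) :
    Tᴴ * T * (signMatrix c d * (Tᴴ * T) * signMatrix c d) = 1 := by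
  have h : Tᴴ * signMatrix c d * T = signMatrix c d := hT
  calc _ = Tᴴ * (T * signMatrix c d * Tᴴ) * T * signMatrix c d := by
        simp only [Matrix.mul_assoc]
    _ = _ := by rw [mul_sign_conjTranspose hT, h, signMatrix_mul_self]

theorem sign_gram_sign_eq {T U : Matrix (Fin c ⊕ Fin d) (Fin c ⊕ Fin d) ℂ}
    (hT : T ∈ formGroup (signMatrix c d)) {l : Fin c ⊕ Fin d → ℝ} (hl : ∀ i, l i ≠ 0)
    (hU : Uᴴ * U = 1) (hU' : U * Uᴴ = 1)
    (h : Tᴴ * T = U * diagonal (fun i => (l i : ℂ)) * Uᴴ) :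
    signMatrix c d * (Tᴴ * T) * signMatrix c d = U * diagonal (fun i => ((l i)⁻¹ : ℂ)) * Uᴴ := by
  have h1 := mul_eq_one_comm.1 (gram_mul_sign_gram hT)
  have h2 : Tᴴ * T * (U * diagonal (fun i => ((l i)⁻¹ : ℂ)) * Uᴴ) = 1 := by
    rw [h]
    calc _ = U * diagonal (fun i => (l i : ℂ)) * (Uᴴ * U) * diagonal (fun i => ((l i)⁻¹ : ℂ)) * Uᴴ := by
          simp only [Matrix.mul_assoc]
      _ = U * (diagonal (fun i => (l i : ℂ)) * diagonal (fun i => ((l i)⁻¹ : ℂ))) * Uᴴ := by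
          rw [hU, Matrix.mul_one]; simp only [Matrix.mul_assoc]
      _ = 1 := by
          rw [diagonal_mul_diagonal]
          have : (fun i => (l i : ℂ) * ((l i)⁻¹ : ℂ)) = fun _ => 1 := by
            ext i; exact mul_inv_cancel₀ (by exact_mod_cast hl i)
          rw [this, diagonal_one, Matrix.mul_one, hU']
  exact left_inv_eq_right_inv h1 h2

theorem isUnit_det_of_mem {T : Matrix (Fin c ⊕ Fin d) (Fin c ⊕ Fin d) ℂ}
    (hT : T ∈ formGroup (signMatrix c d)) : IsUnit T.det := by
  have := congrArg det (gram_mul_sign_gram hT)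
  rw [det_mul, det_mul, det_one, mul_assoc] at this
  rw [mul_comm, mul_assoc] at this
  exact IsUnit.of_mul_eq_one _ this

theorem singularValue_pos_of_isUnit {ι : Type*} [Fintype ι] [DecidableEq ι] {T : Matrix ι ι ℂ}
    (hT : IsUnit T.det) {i : ℕ} (hi : i < Fintype.card ι) : 0 < singularValue T i := by
  have h := prodSq_card T
  have h0 : prodSq (Fintype.card ι) T ≠ 0 := by
    rw [h]; exact pow_ne_zero _ (norm_ne_zero_iff.2 hT.ne_zero)
  have := Finset.prod_ne_zero_iff.1 h0 i (Finset.mem_range.2 hi)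
  exact lt_of_le_of_ne (singularValue_nonneg _ _) (Ne.symm (fun h => this (by simp [h])))

/-- T*T is similar to its inverse through J, so the multiset of the σ² is stable under inversion;
listing both sides in decreasing order pairs each value with its mirror image. -/
theorem singularValue_mul_reflect {T : Matrix (Fin c ⊕ Fin d) (Fin c ⊕ Fin d) ℂ}
    (hT : T ∈ formGroup (signMatrix c d)) {i : ℕ} (hi : i < c + d) :
    singularValue T i * singularValue T (c + d - 1 - i) = 1 := by
  have hcard : Fintype.card (Fin c ⊕ Fin d) = c + d := by simp
  set N := Fintype.card (Fin c ⊕ Fin d)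
  obtain ⟨e, U, hU, hU', h⟩ := exists_unitary_diagonal T
  have hpos : ∀ i < N, 0 < singularValue T i := fun i hi =>
    singularValue_pos_of_isUnit (isUnit_det_of_mem hT) hi
  have hinv := sign_gram_sign_eq hT (l := fun i => singularValue T (e i) ^ 2)
    (fun i => pow_ne_zero _ (hpos _ (e i).2).ne') hU hU' h
  have hch : (signMatrix c d * (Tᴴ * T) * signMatrix c d).charpoly = (Tᴴ * T).charpoly := by
    rw [charpoly_mul_comm, ← Matrix.mul_assoc, signMatrix_mul_self, Matrix.one_mul]
  rw [hinv, h, charpoly_conj_diagonal hU, charpoly_conj_diagonal hU] at hch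
  have hroots := congrArg Polynomial.roots hch
  rw [Polynomial.roots_multiset_prod_X_sub_C, Polynomial.roots_multiset_prod_X_sub_C] at hroots
  have hre := congrArg (Multiset.map Complex.re) hroots
  simp only [Multiset.map_map, Function.comp_def, ← Complex.ofReal_inv, Complex.ofReal_re] at hre
  -- Inversion reverses the order; `Fin.rev` makes both sequences antitone, so equal multisets force
  -- equality.
  have key : (fun j : Fin N => (singularValue T (Fin.rev j) ^ 2)⁻¹) =
      fun j : Fin N => singularValue T j ^ 2 := by
    refine antitone_eq_of_map_eq ?_ ?_ ?_
    · intro a b hab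
      have hab' : ((Fin.rev b : Fin N) : ℕ) ≤ (Fin.rev a : Fin N) := Fin.rev_le_rev.2 hab
      have := singularValue_antitone T hab'
      have h1 := hpos _ (Fin.rev a).2
      dsimp only
      gcongr
    · intro a b hab
      have hab' : (a : ℕ) ≤ b := hab
      have := singularValue_antitone T hab'
      have h1 := singularValue_nonneg T b
      dsimp only
      gcongr
    · have m : ∀ (ε : (Fin c ⊕ Fin d) ≃ Fin N) (g : Fin N → ℝ),
          Finset.univ.val.map (fun i => g (ε i)) = Finset.univ.val.map g := by
        intro ε g
        rw [← Function.comp_def, ← Multiset.map_map]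
        congr 1
        exact congrArg Finset.val (Finset.map_univ_equiv ε)
      rw [← m e (fun j => singularValue T j ^ 2), ← m (e.trans Fin.revPerm)]
      simpa using hre
  have hk := congrFun key ⟨i, by omega⟩
  simp only [Fin.val_rev] at hk
  have e1 : N - (i + 1) = c + d - 1 - i := by omega
  rw [e1] at hk
  have p1 := hpos i (by omega)
  have p2 := hpos (c + d - 1 - i) (by omega)
  have : (singularValue T i * singularValue T (c + d - 1 - i)) ^ 2 = 1 := by
    rw [mul_pow, ← hk]; field_simp
  exact (pow_eq_one_iff_of_nonneg (by positivity) two_ne_zero).1 this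

/-- The matrix factors both through dimension 2d and through dimension 2c. -/
theorem rank_offDiagonal_le (X : Matrix (Fin c) (Fin d) ℂ) (Y : Matrix (Fin d) (Fin c) ℂ) :
    (fromBlocks 0 X Y 0).rank ≤ 2 * min c d := by
  have h1 : fromBlocks 0 X Y 0 = (fromBlocks X 0 0 1 : Matrix (Fin c ⊕ Fin d) (Fin d ⊕ Fin d) ℂ) *
      (fromBlocks 0 1 Y 0 : Matrix (Fin d ⊕ Fin d) (Fin c ⊕ Fin d) ℂ) := by
    simp [fromBlocks_multiply]
  have h2 : fromBlocks 0 X Y 0 = (fromBlocks 1 0 0 Y : Matrix (Fin c ⊕ Fin d) (Fin c ⊕ Fin c) ℂ) *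
      (fromBlocks 0 X 1 0 : Matrix (Fin c ⊕ Fin c) (Fin c ⊕ Fin d) ℂ) := by
    simp [fromBlocks_multiply]
  have h3 : (fromBlocks 0 X Y 0).rank ≤ 2 * d := by
    rw [h1]
    refine (rank_mul_le_left _ _).trans ((rank_le_card_width _).trans ?_)
    simp [two_mul]
  have h4 : (fromBlocks 0 X Y 0).rank ≤ 2 * c := by
    rw [h2]
    refine (rank_mul_le_left _ _).trans ((rank_le_card_width _).trans ?_)
    simp [two_mul]
  omega

/-- T*T - (T*T)⁻¹ = T*T - J T*T J has zero diagonal blocks, hence rank at most 2 min(c, d). Its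
eigenvalues are σ² - σ⁻², which vanish only for σ = 1. -/
theorem card_singularValue_ne_one_le {T : Matrix (Fin c ⊕ Fin d) (Fin c ⊕ Fin d) ℂ}
    (hT : T ∈ formGroup (signMatrix c d)) :
    ((Finset.range (c + d)).filter fun i => singularValue T i ≠ 1).card ≤ 2 * min c d := by
  classical
  have hcard : Fintype.card (Fin c ⊕ Fin d) = c + d := by simp
  obtain ⟨e, U, hU, hU', h⟩ := exists_unitary_diagonal T
  have hpos : ∀ i < Fintype.card (Fin c ⊕ Fin d), 0 < singularValue T i := fun i hi =>
    singularValue_pos_of_isUnit (isUnit_det_of_mem hT) hi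
  have hinv := sign_gram_sign_eq hT (l := fun i => singularValue T (e i) ^ 2)
    (fun i => pow_ne_zero _ (hpos _ (e i).2).ne') hU hU' h
  have hsub : Tᴴ * T - signMatrix c d * (Tᴴ * T) * signMatrix c d =
      fromBlocks 0 ((2 : ℂ) • (Tᴴ * T).toBlocks₁₂) ((2 : ℂ) • (Tᴴ * T).toBlocks₂₁) 0 := by
    conv_lhs => rw [← fromBlocks_toBlocks (Tᴴ * T)]
    simp only [signMatrix, fromBlocks_multiply, sub_eq_add_neg, fromBlocks_neg, fromBlocks_add]
    simp [two_smul]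
  have hrank := rank_offDiagonal_le ((2 : ℂ) • (Tᴴ * T).toBlocks₁₂) ((2 : ℂ) • (Tᴴ * T).toBlocks₂₁)
  rw [← hsub, hinv] at hrank
  nth_rewrite 1 [h] at hrank
  rw [← Matrix.sub_mul, ← Matrix.mul_sub, diagonal_sub, rank_mul_eq_left_of_isUnit_det,
    rank_mul_eq_right_of_isUnit_det, rank_diagonal] at hrank
  rotate_left
  · exact (isUnit_iff_isUnit_det _).1 (IsUnit.of_mul_eq_one _ hU')
  · exact (isUnit_iff_isUnit_det _).1 (IsUnit.of_mul_eq_one _ hU)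
  refine le_trans ?_ hrank
  rw [Fintype.card_subtype]
  refine Finset.card_le_card_of_surjOn (fun i => ((e i : Fin _) : ℕ)) ?_
  intro i hi
  simp only [Finset.coe_filter, Finset.mem_range, Set.mem_ofPred_eq] at hi
  refine ⟨e.symm ⟨i, by omega⟩, ?_, by simp⟩
  simp only [Finset.coe_filter, Finset.mem_univ, true_and, Set.mem_ofPred_eq,
    Equiv.apply_symm_apply]
  intro h0
  apply hi.2
  have p := hpos i (by omega)
  rw [← Complex.ofReal_inv, ← Complex.ofReal_sub, Complex.ofReal_eq_zero, sub_eq_zero] at h0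
  have h4 : singularValue T i ^ 4 = 1 := by
    field_simp at h0
    linarith
  exact (pow_eq_one_iff_of_nonneg p.le (by norm_num)).1 h4

theorem singularValue_eq_one {T : Matrix (Fin c ⊕ Fin d) (Fin c ⊕ Fin d) ℂ}
    (hT : T ∈ formGroup (signMatrix c d)) {i : ℕ} (hi : min c d ≤ i) (hi' : i < max c d) :
    singularValue T i = 1 :=
  eq_one_of_reflect (singularValue_antitone T)
    (fun i hi => singularValue_pos_of_isUnit (isUnit_det_of_mem hT) (by simpa using hi))
    (fun _ hi => singularValue_mul_reflect hT hi) (card_singularValue_ne_one_le hT) i hi hi'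

theorem one_le_singularValue {T : Matrix (Fin c ⊕ Fin d) (Fin c ⊕ Fin d) ℂ}
    (hT : T ∈ formGroup (signMatrix c d)) {i : ℕ} (hi : i < d) : 1 ≤ singularValue T i := by
  rcases le_or_gt (min c d) i with h | h
  · exact (singularValue_eq_one hT h (lt_max_of_lt_right hi)).ge
  · have h1 := singularValue_mul_reflect hT (i := i) (by omega)
    have h2 := singularValue_antitone T (show i ≤ c + d - 1 - i by omega)
    have h3 := singularValue_nonneg T i
    nlinarith

/-- With Q the lower left block, the two Gram matrices are 1 + Q*Q and 1 + QQ*, which have the same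
determinant. -/
theorem norm_det_blocks_eq {T : Matrix (Fin c ⊕ Fin d) (Fin c ⊕ Fin d) ℂ}
    (hT : T ∈ formGroup (signMatrix c d)) : ‖T.toBlocks₁₁.det‖ = ‖T.toBlocks₂₂.det‖ := by
  have h1 : Tᴴ * signMatrix c d * T = signMatrix c d := hT
  have h2 := mul_sign_conjTranspose hT
  rw [← fromBlocks_toBlocks T] at h1 h2
  simp only [signMatrix, fromBlocks_conjTranspose, fromBlocks_multiply, fromBlocks_inj,
    Matrix.mul_one, Matrix.mul_zero, add_zero, zero_add, Matrix.mul_neg, Matrix.neg_mul] at h1 h2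
  have e1 : T.toBlocks₁₁ᴴ * T.toBlocks₁₁ = 1 + T.toBlocks₂₁ᴴ * T.toBlocks₂₁ := by
    rw [← h1.1]; abel
  have e2 : T.toBlocks₂₂ * T.toBlocks₂₂ᴴ = 1 + T.toBlocks₂₁ * T.toBlocks₂₁ᴴ := by
    rw [← neg_inj, ← sub_eq_zero, ← sub_eq_zero.2 h2.2.2.2]; abel
  have h3 := congrArg det e1
  rw [det_one_add_mul_comm, ← e2, det_mul, det_mul, det_conjTranspose, det_conjTranspose,
    Complex.star_def, ← Complex.normSq_eq_conj_mul_self, Complex.mul_conj,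
    Complex.ofReal_inj, Complex.normSq_eq_norm_sq, Complex.normSq_eq_norm_sq] at h3
  exact (pow_left_inj₀ (norm_nonneg _) (norm_nonneg _) two_ne_zero).1 h3

/-- Conjugation by J flips the off-diagonal blocks, so they cancel. The left side has eigenvalues
((σ + σ⁻¹)/2)², which brings in N_d. -/
theorem gram_add_inverse {T : Matrix (Fin c ⊕ Fin d) (Fin c ⊕ Fin d) ℂ}
    (hT : T ∈ formGroup (signMatrix c d)) :
    (4 : ℂ)⁻¹ • (Tᴴ * T + signMatrix c d * (Tᴴ * T) * signMatrix c d + (2 : ℂ) • 1) =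
      fromBlocks (T.toBlocks₁₁ᴴ * T.toBlocks₁₁) 0 0 (T.toBlocks₂₂ᴴ * T.toBlocks₂₂) := by
  have h1 : Tᴴ * signMatrix c d * T = signMatrix c d := hT
  rw [← fromBlocks_toBlocks T] at h1
  simp only [signMatrix, fromBlocks_conjTranspose, fromBlocks_multiply, fromBlocks_inj,
    Matrix.mul_one, Matrix.mul_zero, add_zero, zero_add, Matrix.mul_neg, Matrix.neg_mul] at h1
  have e1 : T.toBlocks₂₁ᴴ * T.toBlocks₂₁ = T.toBlocks₁₁ᴴ * T.toBlocks₁₁ - 1 := by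
    rw [← h1.1]; abel
  have e2 : T.toBlocks₁₂ᴴ * T.toBlocks₁₂ = T.toBlocks₂₂ᴴ * T.toBlocks₂₂ - 1 := by
    rw [← sub_eq_zero, ← sub_eq_zero.2 h1.2.2.2]; abel
  rw [inv_smul_eq_iff₀ (by norm_num)]
  conv_lhs => rw [← fromBlocks_toBlocks T]
  rw [← fromBlocks_one]
  simp only [signMatrix, fromBlocks_conjTranspose, fromBlocks_multiply, fromBlocks_smul,
    fromBlocks_add, Matrix.one_mul, Matrix.zero_mul,
    Matrix.mul_one, Matrix.mul_zero, add_zero, zero_add, Matrix.mul_neg, Matrix.neg_mul, neg_neg,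
    e1, e2, smul_zero, add_neg_cancel]
  congr 1 <;> module

theorem prod_cosh_sq {T : Matrix (Fin c ⊕ Fin d) (Fin c ⊕ Fin d) ℂ}
    (hT : T ∈ formGroup (signMatrix c d)) :
    ∏ i ∈ Finset.range (c + d), ((singularValue T i + (singularValue T i)⁻¹) / 2) ^ 2 =
      ‖T.toBlocks₂₂.det‖ ^ 4 := by
  have hcard : Fintype.card (Fin c ⊕ Fin d) = c + d := by simp
  obtain ⟨e, U, hU, hU', h⟩ := exists_unitary_diagonal T
  have hpos : ∀ i < Fintype.card (Fin c ⊕ Fin d), 0 < singularValue T i := fun i hi =>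
    singularValue_pos_of_isUnit (isUnit_det_of_mem hT) hi
  have hinv := sign_gram_sign_eq hT (l := fun i => singularValue T (e i) ^ 2)
    (fun i => pow_ne_zero _ (hpos _ (e i).2).ne') hU hU' h
  have h1 := gram_add_inverse hT
  rw [hinv] at h1
  nth_rewrite 1 [h] at h1
  have h2 : (4 : ℂ)⁻¹ • (U * diagonal (fun i => ((singularValue T (e i) ^ 2 : ℝ) : ℂ)) * Uᴴ +
      U * diagonal (fun i => (((singularValue T (e i) ^ 2 : ℝ) : ℂ))⁻¹) * Uᴴ + (2 : ℂ) • 1) =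
      U * diagonal (fun i => ((((singularValue T (e i) + (singularValue T (e i))⁻¹) / 2) ^ 2 : ℝ) : ℂ))
        * Uᴴ := by
    have : (fun i => ((((singularValue T (e i) + (singularValue T (e i))⁻¹) / 2) ^ 2 : ℝ) : ℂ)) =
        (4 : ℂ)⁻¹ • ((fun i => ((singularValue T (e i) ^ 2 : ℝ) : ℂ)) +
          (fun i => (((singularValue T (e i) ^ 2 : ℝ) : ℂ))⁻¹) + (2 : ℂ) • 1) := by
      ext i
      have : (singularValue T (e i) : ℂ) ≠ 0 := by exact_mod_cast (hpos _ (e i).2).ne'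
      simp only [Pi.smul_apply, Pi.add_apply, Pi.one_apply, smul_eq_mul]
      push_cast
      field_simp
      ring
    rw [this, diagonal_smul]
    erw [← diagonal_add, ← diagonal_add, diagonal_smul]
    simp only [Matrix.mul_smul, Matrix.smul_mul, Matrix.mul_add, Matrix.add_mul]
    rw [show diagonal (1 : Fin c ⊕ Fin d → ℂ) = 1 from diagonal_one, Matrix.mul_one, hU']
  rw [h2] at h1
  have h3 := congrArg det h1
  rw [det_mul_right_comm, hU', Matrix.one_mul, det_diagonal, det_fromBlocks_zero₁₂,
    det_mul, det_mul, det_conjTranspose, det_conjTranspose,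
    Complex.star_def, ← Complex.normSq_eq_conj_mul_self,
    ← Complex.normSq_eq_conj_mul_self, ← Complex.ofReal_prod, ← Complex.ofReal_mul,
    Complex.ofReal_inj, Complex.normSq_eq_norm_sq, Complex.normSq_eq_norm_sq,
    norm_det_blocks_eq hT,
    e.prod_comp (fun i => ((singularValue T i + (singularValue T i)⁻¹) / 2) ^ 2)] at h3
  rw [← hcard, ← Fin.prod_univ_eq_prod_range (fun i =>
    ((singularValue T i + (singularValue T i)⁻¹) / 2) ^ 2), h3]
  ring

theorem logCoshSum_eq_log_norm_det {T : Matrix (Fin c ⊕ Fin d) (Fin c ⊕ Fin d) ℂ}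
    (hT : T ∈ formGroup (signMatrix c d)) :
    logCoshSum d T = Real.log ‖T.toBlocks₂₂.det‖ := by
  have hpos : ∀ i < c + d, 0 < singularValue T i := fun i hi =>
    singularValue_pos_of_isUnit (isUnit_det_of_mem hT) (by simpa using hi)
  have h1 := prod_range_eq_sq_of_reflect (c := c) (d := d)
    (p := fun i => ((singularValue T i + (singularValue T i)⁻¹) / 2) ^ 2) (fun i hi => by
      have := singularValue_mul_reflect hT hi
      rw [eq_inv_of_mul_eq_one_right this, inv_inv, add_comm]) (fun i hi hi' => by
      rw [singularValue_eq_one hT hi hi']; norm_num)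
  -- Both sides are now fourth powers: one square comes from the Gram matrix, the other from the
  -- reflection symmetry.
  rw [prod_cosh_sq hT, Finset.prod_pow, ← pow_mul] at h1
  have h2 := (pow_left_inj₀ (norm_nonneg _) (Finset.prod_nonneg fun i hi => by
    have := singularValue_nonneg T i; positivity) (by norm_num)).1 h1
  rw [logCoshSum, h2, Real.log_prod]
  intro i hi
  have := hpos i (by have := Finset.mem_range.1 hi; omega)
  positivity

theorem logCoshSum_le {T : Matrix (Fin c ⊕ Fin d) (Fin c ⊕ Fin d) ℂ}
    (hT : T ∈ formGroup (signMatrix c d)) :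
    logCoshSum d T ≤ ∑ i ∈ Finset.range d, Real.log (singularValue T i) := by
  refine Finset.sum_le_sum fun i hi => ?_
  have h := one_le_singularValue hT (Finset.mem_range.1 hi)
  have h2 := inv_le_one_of_one_le₀ h
  exact Real.log_le_log (by positivity) (by linarith)

theorem le_logCoshSum {T : Matrix (Fin c ⊕ Fin d) (Fin c ⊕ Fin d) ℂ}
    (hT : T ∈ formGroup (signMatrix c d)) :
    ∑ i ∈ Finset.range d, Real.log (singularValue T i) - d * Real.log 2 ≤ logCoshSum d T := by
  have : (d : ℝ) * Real.log 2 = ∑ i ∈ Finset.range d, Real.log 2 := by simp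
  rw [this, ← Finset.sum_sub_distrib]
  refine Finset.sum_le_sum fun i hi => ?_
  have h := one_le_singularValue hT (Finset.mem_range.1 hi)
  have h0 : 0 < singularValue T i := by linarith
  rw [← Real.log_div h0.ne' two_ne_zero]
  have := inv_pos.2 h0
  exact Real.log_le_log (by positivity) (by linarith)

theorem logCoshSum_nonneg {T : Matrix (Fin c ⊕ Fin d) (Fin c ⊕ Fin d) ℂ}
    (hT : T ∈ formGroup (signMatrix c d)) : 0 ≤ logCoshSum d T := by
  refine Finset.sum_nonneg fun i hi => Real.log_nonneg ?_
  have h := one_le_singularValue hT (Finset.mem_range.1 hi)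
  have h0 : 0 < singularValue T i := by linarith
  have : singularValue T i * (singularValue T i)⁻¹ = 1 := mul_inv_cancel₀ h0.ne'
  have := inv_pos.2 h0
  nlinarith [sq_nonneg (singularValue T i - 1)]

end PseudoUnitary

/-! ### Extension of the rotation to the unit disc and the mean value property -/

section MeanValue

theorem integral_log_norm_exp_eq {g : ℂ → ℂ} (hg : Differentiable ℂ g)
    (h0 : ∀ z, ‖z‖ ≤ 1 → g z ≠ 0) :
    ∫ θ in (0 : ℝ)..1, Real.log ‖g (Complex.exp (2 * Real.pi * Complex.I * θ))‖ =
      Real.log ‖g 0‖ := by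
  have h := AnalyticOnNhd.circleAverage_log_norm_of_ne_zero (c := 0) (R := 1) (g := g)
    (fun z _ => hg.analyticAt z) (fun u hu => h0 u (by simpa using hu))
  rw [Real.circleAverage_def] at h
  have h2 := intervalIntegral.integral_comp_mul_left (a := 0) (b := 1)
    (fun θ : ℝ => Real.log ‖g (circleMap 0 1 θ)‖) (c := 2 * Real.pi) (by positivity)
  rw [mul_zero, mul_one, h] at h2
  rw [← h2]
  refine intervalIntegral.integral_congr fun θ _ => ?_
  simp only [circleMap]
  congr 3
  push_cast
  ring_nf

variable {c d : ℕ}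

/-- The block diagonal matrix with blocks `z 1_c` and `1_d`. -/
def blockScale (c d : ℕ) (z : ℂ) : Matrix (Fin c ⊕ Fin d) (Fin c ⊕ Fin d) ℂ :=
  fromBlocks (z • 1) 0 0 1

theorem blockRotation_eq (θ : ℝ) :
    blockRotation c d θ = blockScale c d (Complex.exp (2 * Real.pi * Complex.I * θ)) := rfl

/-- The quadratic form of signature `(c, d)`. -/
def signForm (w : Fin c ⊕ Fin d → ℂ) : ℝ :=
  ∑ i, Complex.normSq (w (Sum.inl i)) - ∑ j, Complex.normSq (w (Sum.inr j))

theorem ofReal_signForm (w : Fin c ⊕ Fin d → ℂ) :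
    (signForm w : ℂ) = star w ⬝ᵥ (signMatrix c d *ᵥ w) := by
  rw [signMatrix, fromBlocks_mulVec, dotProduct, Fintype.sum_sum_type]
  simp [signForm, Complex.normSq_eq_conj_mul_self, sub_eq_add_neg, neg_mulVec]

theorem signForm_mulVec {T : Matrix (Fin c ⊕ Fin d) (Fin c ⊕ Fin d) ℂ}
    (hT : T ∈ formGroup (signMatrix c d)) (w : Fin c ⊕ Fin d → ℂ) :
    signForm (T *ᵥ w) = signForm w := by
  have h : Tᴴ * signMatrix c d * T = signMatrix c d := hT
  rw [← Complex.ofReal_inj, ofReal_signForm, ofReal_signForm, star_mulVec]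
  nth_rewrite 2 [← h]
  simp only [← dotProduct_mulVec, mulVec_mulVec, Matrix.mul_assoc]

theorem signForm_blockScale_le {z : ℂ} (hz : ‖z‖ ≤ 1) (w : Fin c ⊕ Fin d → ℂ) :
    signForm (blockScale c d z *ᵥ w) ≤ signForm w := by
  rw [blockScale, fromBlocks_mulVec]
  simp only [signForm, Sum.elim_inl, Sum.elim_inr, smul_mulVec, one_mulVec, zero_mulVec, add_zero,
    zero_add, Pi.smul_apply, smul_eq_mul, Complex.normSq_mul, Function.comp_apply]
  refine sub_le_sub_right (Finset.sum_le_sum fun i _ => ?_) _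
  refine mul_le_of_le_one_left (Complex.normSq_nonneg _) ?_
  rw [Complex.normSq_eq_norm_sq]
  exact pow_le_one₀ (norm_nonneg _) hz

variable {X : Type*} {f : X → X} {A : X → Matrix (Fin c ⊕ Fin d) (Fin c ⊕ Fin d) ℂ}

theorem signForm_cocycleIterate_le (hA : ∀ x, A x ∈ formGroup (signMatrix c d)) {z : ℂ}
    (hz : ‖z‖ ≤ 1) (n : ℕ) (x : X) (w : Fin c ⊕ Fin d → ℂ) :
    signForm (cocycleIterate f (fun x => blockScale c d z * A x) n x *ᵥ w) ≤ signForm w := by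
  induction n with
  | zero => simp [cocycleIterate]
  | succ n ih =>
    rw [cocycleIterate, ← mulVec_mulVec, ← mulVec_mulVec]
    refine (signForm_blockScale_le hz _).trans ?_
    rwa [signForm_mulVec (hA _)]

/-- A kernel vector v of the lower right block would give w = (0, v) with negative form, whereas Mw
has vanishing second component and so nonnegative form. -/
theorem det_toBlocks₂₂_ne_zero {M : Matrix (Fin c ⊕ Fin d) (Fin c ⊕ Fin d) ℂ}
    (hM : ∀ w, signForm (M *ᵥ w) ≤ signForm w) : M.toBlocks₂₂.det ≠ 0 := by
  intro h0
  obtain ⟨v, hv, hv0⟩ := exists_mulVec_eq_zero_iff.2 h0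
  have h := hM (Sum.elim 0 v)
  rw [← fromBlocks_toBlocks M, fromBlocks_mulVec] at h
  simp only [Sum.elim_comp_inl, Sum.elim_comp_inr, mulVec_zero, zero_add, hv0, signForm,
    Sum.elim_inl, Sum.elim_inr, Pi.zero_apply, map_zero, Finset.sum_const_zero, sub_zero,
    zero_sub] at h
  have h1 : 0 ≤ ∑ i, Complex.normSq ((M.toBlocks₁₂ *ᵥ v) i) :=
    Finset.sum_nonneg fun _ _ => Complex.normSq_nonneg _
  have h2 : ∑ j, Complex.normSq (v j) ≤ 0 := by linarith
  apply hv
  ext j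
  have h3 := (Finset.sum_eq_zero_iff_of_nonneg fun j _ => Complex.normSq_nonneg (v j)).1
    (le_antisymm h2 (Finset.sum_nonneg fun _ _ => Complex.normSq_nonneg _)) j (Finset.mem_univ j)
  exact Complex.normSq_eq_zero.1 h3

theorem differentiable_cocycleIterate (n : ℕ) (x : X) (i j : Fin c ⊕ Fin d) :
    Differentiable ℂ fun z => cocycleIterate f (fun x => blockScale c d z * A x) n x i j := by
  induction n generalizing i j with
  | zero => simp [cocycleIterate]
  | succ n ih =>
    have hb : ∀ i j, Differentiable ℂ fun z => blockScale c d z i j := by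
      rintro (i | i) (j | j) <;> simp [blockScale]
    simp only [cocycleIterate, mul_apply]
    fun_prop

theorem differentiable_det_cocycleIterate (n : ℕ) (x : X) :
    Differentiable ℂ fun z =>
      (cocycleIterate f (fun x => blockScale c d z * A x) n x).toBlocks₂₂.det := by
  simp only [det_apply, toBlocks₂₂, of_apply]
  have := differentiable_cocycleIterate (f := f) (A := A) n x
  fun_prop

/-- At z = 0 the upper rows of every factor vanish, so the lower right blocks simply multiply. -/
theorem det_cocycleIterate_zero (n : ℕ) (x : X) :
    (cocycleIterate f (fun x => blockScale c d 0 * A x) n x).toBlocks₂₂.det =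
      ∏ k ∈ Finset.range n, (A (f^[k] x)).toBlocks₂₂.det := by
  have h : ∀ n, (cocycleIterate f (fun x => blockScale c d 0 * A x) n x).toBlocks₁₂ = 0 ∧
      (cocycleIterate f (fun x => blockScale c d 0 * A x) (n + 1) x).toBlocks₂₂ =
        (A (f^[n] x)).toBlocks₂₂ *
          (cocycleIterate f (fun x => blockScale c d 0 * A x) n x).toBlocks₂₂ := by
    intro n
    have key : (cocycleIterate f (fun x => blockScale c d 0 * A x) n x).toBlocks₁₂ = 0 := by
      cases n with
      | zero => rw [cocycleIterate, ← fromBlocks_one, toBlocks_fromBlocks₁₂]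
      | succ n =>
        rw [cocycleIterate, ← fromBlocks_toBlocks (A _), ← fromBlocks_toBlocks (cocycleIterate _ _ _ _)]
        simp [blockScale, fromBlocks_multiply]
    refine ⟨key, ?_⟩
    rw [cocycleIterate]
    conv_lhs => rw [← fromBlocks_toBlocks (A _), ← fromBlocks_toBlocks (cocycleIterate _ _ _ _), key]
    simp [blockScale, fromBlocks_multiply]
  induction n with
  | zero => rw [cocycleIterate, ← fromBlocks_one, toBlocks_fromBlocks₂₂]; simp
  | succ n ih => rw [(h n).2, det_mul, ih, Finset.prod_range_succ, mul_comm]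

theorem integral_log_norm_det_cocycleIterate (hA : ∀ x, A x ∈ formGroup (signMatrix c d))
    (n : ℕ) (x : X) :
    ∫ θ in (0 : ℝ)..1, Real.log
        ‖(cocycleIterate f (fun x => blockRotation c d θ * A x) n x).toBlocks₂₂.det‖ =
      ∑ k ∈ Finset.range n, logCoshSum d (A (f^[k] x)) := by
  have h := integral_log_norm_exp_eq (differentiable_det_cocycleIterate (f := f) (A := A) n x)
    fun z hz => det_toBlocks₂₂_ne_zero (signForm_cocycleIterate_le hA hz n x)
  simp only [blockRotation_eq]
  rw [h, det_cocycleIterate_zero, norm_prod, Real.log_prod]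
  · exact Finset.sum_congr rfl fun k _ => (logCoshSum_eq_log_norm_det (hA _)).symm
  · exact fun k _ => norm_ne_zero_iff.2
      (det_toBlocks₂₂_ne_zero fun w => (signForm_mulVec (hA _) w).le)

end MeanValue

/-! ### Subadditivity and existence of the Lyapunov exponents -/

section LyapunovExponents

variable {ι : Type*} [Fintype ι] [DecidableEq ι]

/-- The sum of the logarithms of the `k` largest singular values. -/
noncomputable def logProd (k : ℕ) (T : Matrix ι ι ℂ) : ℝ :=
  ∑ i ∈ Finset.range k, Real.log (singularValue T i)

theorem isUnit_det_of_norm_eq_one {T : Matrix ι ι ℂ} (hT : ‖T.det‖ = 1) : IsUnit T.det := by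
  rw [isUnit_iff_ne_zero, ← norm_ne_zero_iff, hT]; exact one_ne_zero

theorem prodSq_pos {T : Matrix ι ι ℂ} (hT : IsUnit T.det) {k : ℕ} (hk : k ≤ Fintype.card ι) :
    0 < prodSq k T :=
  Finset.prod_pos fun _ hi => pow_pos
    (singularValue_pos_of_isUnit hT ((Finset.mem_range.1 hi).trans_le hk)) 2

theorem logProd_eq {T : Matrix ι ι ℂ} (hT : IsUnit T.det) {k : ℕ} (hk : k ≤ Fintype.card ι) :
    logProd k T = 2⁻¹ * Real.log (prodSq k T) := by
  rw [prodSq, Real.log_prod, logProd, Finset.mul_sum]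
  · refine Finset.sum_congr rfl fun i _ => ?_
    rw [Real.log_pow]; push_cast; ring
  · exact fun i hi => (pow_pos
      (singularValue_pos_of_isUnit hT ((Finset.mem_range.1 hi).trans_le hk)) 2).ne'

theorem logProd_mul_le {S T : Matrix ι ι ℂ} (hS : IsUnit S.det) (hT : IsUnit T.det) {k : ℕ}
    (hk : k ≤ Fintype.card ι) : logProd k (S * T) ≤ logProd k S + logProd k T := by
  have hST : IsUnit (S * T).det := by rw [det_mul]; exact hS.mul hT
  rw [logProd_eq hS hk, logProd_eq hT hk, logProd_eq hST hk, ← mul_add,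
    ← Real.log_mul (prodSq_pos hS hk).ne' (prodSq_pos hT hk).ne']
  have := Real.log_le_log (prodSq_pos hST hk) (prodSq_mul_le hk S T)
  linarith

theorem logProd_of_unitary {U : Matrix ι ι ℂ} (hU : Uᴴ * U = 1) {k : ℕ}
    (hk : k ≤ Fintype.card ι) : logProd k U = 0 := by
  obtain ⟨W, hW, h⟩ := exists_det_gram_eq U hk
  rw [hU, Matrix.mul_one, hW, det_one, Complex.one_re] at h
  have hu : IsUnit U.det := by
    have := congrArg det hU
    rw [det_mul, det_one] at this
    exact IsUnit.of_mul_eq_one_right _ this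
  rw [logProd_eq hu hk, ← h, Real.log_one, mul_zero]

theorem logProd_card {T : Matrix ι ι ℂ} (hT : ‖T.det‖ = 1) : logProd (Fintype.card ι) T = 0 := by
  rw [logProd_eq (isUnit_det_of_norm_eq_one hT) le_rfl, prodSq_card, hT]; simp

/-- The ln σ_i decrease and sum to ln |det T| = 0, so every partial sum is nonnegative. This lower
bound is why integrability of ln ‖A‖ alone suffices and why Fekete's limit is finite. -/
theorem logProd_nonneg {T : Matrix ι ι ℂ} (hT : ‖T.det‖ = 1) {k : ℕ} (hk : k ≤ Fintype.card ι) :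
    0 ≤ logProd k T := by
  have hanti : ∀ i j, i ≤ j → j < Fintype.card ι →
      Real.log (singularValue T j) ≤ Real.log (singularValue T i) := fun i j hij hj =>
    Real.log_le_log (singularValue_pos_of_isUnit (isUnit_det_of_norm_eq_one hT) hj)
      (singularValue_antitone T hij)
  rcases hk.eq_or_lt with rfl | hk'
  · exact (logProd_card hT).ge
  by_cases h : 0 ≤ Real.log (singularValue T k)
  · exact Finset.sum_nonneg fun i hi => h.trans (hanti _ _ (Finset.mem_range.1 hi).le hk')
  · have h1 := logProd_card hT
    rw [logProd, ← Finset.sum_range_add_sum_Ico _ hk] at h1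
    have h2 : ∑ i ∈ Finset.Ico k (Fintype.card ι), Real.log (singularValue T i) ≤ 0 :=
      Finset.sum_nonpos fun i hi =>
        (hanti _ _ (Finset.mem_Ico.1 hi).1 (Finset.mem_Ico.1 hi).2).trans (not_le.1 h).le
    unfold logProd
    linarith

theorem logProd_le_log_norm {T : Matrix ι ι ℂ} (hT : IsUnit T.det) {k : ℕ}
    (hk : k ≤ Fintype.card ι) :
    logProd k T ≤ k * Real.log ‖Matrix.toEuclideanCLM (n := ι) (𝕜 := ℂ) T‖ := by
  have : logProd k T ≤ ∑ _i ∈ Finset.range k,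
      Real.log ‖Matrix.toEuclideanCLM (n := ι) (𝕜 := ℂ) T‖ :=
    Finset.sum_le_sum fun i hi => Real.log_le_log
      (singularValue_pos_of_isUnit hT ((Finset.mem_range.1 hi).trans_le hk))
      (singularValue_le_norm T i)
  simpa using this

/-- The bound does not depend on T, so it disappears from exponents after division by n. -/
theorem abs_logProd_conj_sub_le {B T : Matrix ι ι ℂ} (hB : IsUnit B.det) (hT : IsUnit T.det)
    {k : ℕ} (hk : k ≤ Fintype.card ι) :
    |logProd k (B * T * B⁻¹) - logProd k T| ≤ logProd k B + logProd k B⁻¹ := by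
  have hB' : IsUnit (B⁻¹).det := isUnit_nonsing_inv_det _ hB
  have h1 : IsUnit (B * T).det := by rw [det_mul]; exact hB.mul hT
  have h2 : IsUnit (B * T * B⁻¹).det := by rw [det_mul]; exact h1.mul hB'
  have h3 : IsUnit (B⁻¹ * (B * T * B⁻¹)).det := by rw [det_mul]; exact hB'.mul h2
  have e : T = B⁻¹ * (B * T * B⁻¹) * B := by
    rw [Matrix.mul_assoc B, nonsing_inv_mul_cancel_left _ _ hB, nonsing_inv_mul_cancel_right _ _ hB]
  have l1 := logProd_mul_le h1 hB' hk
  have l2 := logProd_mul_le hB hT hk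
  have l3 := logProd_mul_le h3 hB hk
  have l4 := logProd_mul_le hB' h2 hk
  rw [← e] at l3
  rw [abs_le]
  constructor <;> linarith

variable {X : Type*} {f : X → X} {C : X → Matrix ι ι ℂ}

theorem cocycleIterate_add (m n : ℕ) (x : X) :
    cocycleIterate f C (m + n) x = cocycleIterate f C m (f^[n] x) * cocycleIterate f C n x := by
  induction m with
  | zero => simp [cocycleIterate]
  | succ m ih =>
    rw [Nat.succ_add, cocycleIterate, ih, cocycleIterate, Matrix.mul_assoc, ← Function.iterate_add_apply]

theorem norm_det_cocycleIterate (hdet : ∀ x, ‖(C x).det‖ = 1) (n : ℕ) (x : X) :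
    ‖(cocycleIterate f C n x).det‖ = 1 := by
  induction n with
  | zero => simp [cocycleIterate]
  | succ n ih => rw [cocycleIterate, det_mul, norm_mul, hdet, ih, one_mul]

theorem logProd_cocycleIterate_le (hdet : ∀ x, ‖(C x).det‖ = 1) {k : ℕ}
    (hk : k ≤ Fintype.card ι) (n : ℕ) (x : X) :
    logProd k (cocycleIterate f C n x) ≤ ∑ j ∈ Finset.range n, logProd k (C (f^[j] x)) := by
  induction n with
  | zero => simpa [cocycleIterate] using (logProd_of_unitary (by simp) hk).le
  | succ n ih =>
    rw [cocycleIterate, Finset.sum_range_succ, add_comm]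
    exact (logProd_mul_le (isUnit_det_of_norm_eq_one (hdet _))
      (isUnit_det_of_norm_eq_one (norm_det_cocycleIterate hdet _ _)) hk).trans
      (add_le_add_right ih _)

variable [MeasurableSpace X] {μ : Measure X}

theorem measurable_logProd {A : X → Matrix ι ι ℂ} (hA : ∀ i j, Measurable fun x => A x i j)
    (hdet : ∀ x, IsUnit (A x).det) {k : ℕ} (hk : k ≤ Fintype.card ι) :
    Measurable fun x => logProd k (A x) := by
  simp only [fun x => logProd_eq (hdet x) hk]
  have h1 : Measurable fun x => (fun i j => A x i j : ι → ι → ℂ) :=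
    measurable_pi_iff.2 fun i => measurable_pi_iff.2 fun j => hA i j
  have h2 : Measurable fun T : ι → ι → ℂ => prodSq k (T : Matrix ι ι ℂ) :=
    Continuous.measurable (show Continuous fun T : ι → ι → ℂ => prodSq k (T : Matrix ι ι ℂ) from
      continuous_prodSq hk)
  exact (Real.measurable_log.comp (h2.comp h1)).const_mul _

theorem measurable_cocycleIterate (hf : Measurable f) (hC : ∀ i j, Measurable fun x => C x i j)
    (n : ℕ) (i j : ι) : Measurable fun x => cocycleIterate f C n x i j := by
  induction n generalizing i j with
  | zero => exact measurable_const
  | succ n ih =>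
    simp only [cocycleIterate, mul_apply]
    exact Finset.measurable_sum _ fun l _ => ((hC i l).comp (hf.iterate n)).mul (ih l j)

theorem integrable_comp_iterate (hf : MeasurePreserving f μ μ) {g : X → ℝ} (hg : Integrable g μ)
    (j : ℕ) : Integrable (fun x => g (f^[j] x)) μ :=
  (hf.iterate j).integrable_comp_of_integrable hg

theorem integral_comp_iterate (hf : MeasurePreserving f μ μ) {g : X → ℝ} (hg : Integrable g μ)
    (j : ℕ) : ∫ x, g (f^[j] x) ∂μ = ∫ x, g x ∂μ := by
  have h := hf.iterate j
  have hg' : AEStronglyMeasurable g (μ.map f^[j]) := by rw [h.map_eq]; exact hg.1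
  rw [← integral_map h.measurable.aemeasurable hg', h.map_eq]

theorem integrable_logProd_cocycleIterate (hf : MeasurePreserving f μ μ)
    (hC : ∀ i j, Measurable fun x => C x i j) (hdet : ∀ x, ‖(C x).det‖ = 1) {k : ℕ}
    (hk : k ≤ Fintype.card ι) (hint : Integrable (fun x => logProd k (C x)) μ) (n : ℕ) :
    Integrable (fun x => logProd k (cocycleIterate f C n x)) μ := by
  have hd := fun x => norm_det_cocycleIterate (f := f) hdet n x
  refine Integrable.mono' (integrable_finsetSum (Finset.range n) fun j _ =>
      integrable_comp_iterate hf hint j)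
    (measurable_logProd (measurable_cocycleIterate hf.measurable hC n)
      (fun x => isUnit_det_of_norm_eq_one (hd x)) hk).aestronglyMeasurable
    (ae_of_all _ fun x => ?_)
  rw [Real.norm_of_nonneg (logProd_nonneg (hd x) hk)]
  exact logProd_cocycleIterate_le hdet hk n x

/-- Fekete's lemma: submultiplicativity along the orbit and invariance of μ make the integrals
subadditive, and they are bounded below by 0. -/
theorem exists_tendsto_integral_logProd (hf : MeasurePreserving f μ μ)
    (hC : ∀ i j, Measurable fun x => C x i j) (hdet : ∀ x, ‖(C x).det‖ = 1) {k : ℕ}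
    (hk : k ≤ Fintype.card ι) (hint : Integrable (fun x => logProd k (C x)) μ) :
    ∃ L : ℝ, Tendsto (fun n : ℕ => (1 / (n : ℝ)) * ∫ x, logProd k (cocycleIterate f C n x) ∂μ)
      atTop (𝓝 L) := by
  have hI := integrable_logProd_cocycleIterate hf hC hdet hk hint
  have hsub : Subadditive fun n : ℕ => ∫ x, logProd k (cocycleIterate f C n x) ∂μ := by
    intro m n
    dsimp only
    rw [← integral_comp_iterate hf (hI m) n, ← integral_add (integrable_comp_iterate hf (hI m) n) (hI n)]
    refine integral_mono (hI _) ((integrable_comp_iterate hf (hI m) n).add (hI n)) fun x => ?_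
    simp only [cocycleIterate_add]
    exact logProd_mul_le (isUnit_det_of_norm_eq_one (norm_det_cocycleIterate hdet _ _))
      (isUnit_det_of_norm_eq_one (norm_det_cocycleIterate hdet _ _)) hk
  refine ⟨hsub.lim, ?_⟩
  have := hsub.tendsto_lim ⟨0, ?_⟩
  · simpa [div_eq_inv_mul] using this
  · rintro _ ⟨n, rfl⟩
    exact div_nonneg (integral_nonneg fun x =>
      logProd_nonneg (norm_det_cocycleIterate hdet n x) hk) n.cast_nonneg

theorem log_singularValue_eq (T : Matrix ι ι ℂ) (k : ℕ) :
    Real.log (singularValue T k) = logProd (k + 1) T - logProd k T := by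
  rw [logProd, logProd, Finset.sum_range_succ, add_sub_cancel_left]

/-- A single ln σ_k is not subadditive; it is the difference of two consecutive `logProd`, whose
means both converge. -/
theorem lyapunovExponentExists_of_integrable (hf : MeasurePreserving f μ μ)
    (hC : ∀ i j, Measurable fun x => C x i j) (hdet : ∀ x, ‖(C x).det‖ = 1)
    (hint : ∀ k ≤ Fintype.card ι, Integrable (fun x => logProd k (C x)) μ) {k : ℕ}
    (hk : k < Fintype.card ι) : LyapunovExponentExists μ f C k := by
  have I1 := integrable_logProd_cocycleIterate hf hC hdet hk.le (hint k hk.le)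
  have I2 := integrable_logProd_cocycleIterate hf hC hdet (Nat.succ_le_of_lt hk) (hint _ hk)
  obtain ⟨L1, h1⟩ := exists_tendsto_integral_logProd hf hC hdet hk.le (hint k hk.le)
  obtain ⟨L2, h2⟩ := exists_tendsto_integral_logProd hf hC hdet (Nat.succ_le_of_lt hk) (hint _ hk)
  refine ⟨fun n => ?_, L2 - L1, ?_⟩
  · simp only [log_singularValue_eq]
    exact (I2 n).sub (I1 n)
  · refine (h2.sub h1).congr fun n => ?_
    rw [meanLogSingularValue, ← mul_sub, ← integral_sub (I2 n) (I1 n)]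
    simp only [log_singularValue_eq]

theorem tendsto_lyapunovSum {r : ℕ} (h : ∀ k < r, LyapunovExponentExists μ f C k) :
    Tendsto (fun n : ℕ => (1 / (n : ℝ)) * ∫ x, logProd r (cocycleIterate f C n x) ∂μ) atTop
      (𝓝 (lyapunovSum μ f C r)) := by
  have h1 : Tendsto (fun n => ∑ k ∈ Finset.range r, meanLogSingularValue μ f C k n) atTop
      (𝓝 (lyapunovSum μ f C r)) := by
    refine tendsto_finsetSum _ fun k hk => ?_
    obtain ⟨L, hL⟩ := (h k (Finset.mem_range.1 hk)).2
    rw [lyapunovExponent, hL.limUnder_eq]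
    exact hL
  refine h1.congr fun n => ?_
  simp only [meanLogSingularValue, logProd]
  rw [integral_finsetSum _ fun k hk => (h k (Finset.mem_range.1 hk)).1 n, Finset.mul_sum]

end LyapunovExponents

/-! ### Reduction to the standard form and integration over the base and the circle -/

section MainTheorem

variable {c d : ℕ}

/-- Sylvester's law of inertia: diagonalize, order the positive eigenvalues first, and absorb the
square roots of their absolute values into B. -/
theorem exists_conjTranspose_mul_signMatrix_mul
    {𝒢 : Matrix (Fin c ⊕ Fin d) (Fin c ⊕ Fin d) ℂ} (h𝒢 : IsUnit 𝒢) (hsig : HasSignature 𝒢 c d) :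
    ∃ B : Matrix (Fin c ⊕ Fin d) (Fin c ⊕ Fin d) ℂ, IsUnit B.det ∧
      𝒢 = Bᴴ * signMatrix c d * B := by
  obtain ⟨hH, hc, hd⟩ := hsig
  have hdet : 𝒢.det ≠ 0 := ((isUnit_iff_isUnit_det _).1 h𝒢).ne_zero
  have hne : ∀ i, hH.eigenvalues i ≠ 0 := by
    intro i hi
    apply hdet
    rw [hH.det_eq_prod_eigenvalues]
    exact Finset.prod_eq_zero (Finset.mem_univ i) (by rw [hi]; simp)
  let e1 : Fin c ≃ {i // 0 < hH.eigenvalues i} := (Finite.equivFinOfCardEq hc).symm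
  -- Invertibility excludes the eigenvalue 0, so nonpositive means negative.
  let e2 : Fin d ≃ {i // ¬ 0 < hH.eigenvalues i} :=
    (Finite.equivFinOfCardEq hd).symm.trans (Equiv.subtypeEquivRight fun i =>
      ⟨fun h => not_lt.2 h.le, fun h => lt_of_le_of_ne (not_lt.1 h) (hne i)⟩)
  let e : Fin c ⊕ Fin d ≃ Fin c ⊕ Fin d := (Equiv.sumCongr e1 e2).trans (Equiv.sumCompl _)
  have he1 : ∀ i, 0 < hH.eigenvalues (e (Sum.inl i)) := fun i => (e1 i).2
  have he2 : ∀ j, hH.eigenvalues (e (Sum.inr j)) ≤ 0 := fun j => not_lt.1 (e2 j).2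
  let U : Matrix (Fin c ⊕ Fin d) (Fin c ⊕ Fin d) ℂ := hH.eigenvectorUnitary
  let D : Matrix (Fin c ⊕ Fin d) (Fin c ⊕ Fin d) ℂ :=
    diagonal fun i => ((√|hH.eigenvalues (e i)| : ℝ) : ℂ)
  have hD : Dᴴ = D := by
    simp only [D, diagonal_conjTranspose]
    congr 1
    ext i
    simp
  have hDG : D * signMatrix c d * D = diagonal fun i => (hH.eigenvalues (e i) : ℂ) := by
    have hG : signMatrix c d = diagonal (Sum.elim (fun _ => 1) (fun _ => -1)) := by
      rw [signMatrix, ← diagonal_one, ← diagonal_one, diagonal_neg, fromBlocks_diagonal]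
    rw [hG, diagonal_mul_diagonal, diagonal_mul_diagonal]
    congr 1
    ext i
    have hs : ((√|hH.eigenvalues (e i)| : ℝ) : ℂ) * ((√|hH.eigenvalues (e i)| : ℝ) : ℂ) =
        ((|hH.eigenvalues (e i)| : ℝ) : ℂ) := by
      rw [← Complex.ofReal_mul, Real.mul_self_sqrt (abs_nonneg _)]
    rcases i with i | j
    · rw [Sum.elim_inl, mul_one, hs, abs_of_pos (he1 i)]
    · rw [Sum.elim_inr, mul_neg_one, neg_mul, hs, abs_of_nonpos (he2 j)]
      push_cast
      ring
  have hB : 𝒢 = (D * Uᴴ.submatrix e id)ᴴ * signMatrix c d * (D * Uᴴ.submatrix e id) := by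
    calc 𝒢 = U * diagonal (fun i => (hH.eigenvalues i : ℂ)) * Uᴴ := by
          conv_lhs => rw [hH.spectral_theorem, Unitary.conjStarAlgAut_apply]
          rfl
      _ = U.submatrix id e * (diagonal fun i => (hH.eigenvalues i : ℂ)).submatrix e e *
            Uᴴ.submatrix e id := by
          rw [submatrix_mul_equiv, submatrix_mul_equiv, submatrix_id_id]
      _ = _ := by
          rw [submatrix_diagonal_equiv, conjTranspose_mul, conjTranspose_submatrix,
            conjTranspose_conjTranspose, hD]
          simp only [Function.comp_def]
          rw [← hDG]
          simp only [Matrix.mul_assoc]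
  refine ⟨D * Uᴴ.submatrix e id, ?_, hB⟩
  rw [isUnit_iff_ne_zero]
  intro h0
  apply hdet
  rw [hB, det_mul, h0, mul_zero]

theorem conj_mem_formGroup {𝒢 B T : Matrix (Fin c ⊕ Fin d) (Fin c ⊕ Fin d) ℂ}
    (hB : IsUnit B.det) (h : 𝒢 = Bᴴ * signMatrix c d * B) (hT : T ∈ formGroup 𝒢) :
    B * T * B⁻¹ ∈ formGroup (signMatrix c d) := by
  have hT' : Tᴴ * 𝒢 * T = 𝒢 := hT
  have hB' : IsUnit Bᴴ.det := by rw [det_conjTranspose]; exact hB.star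
  change (B * T * B⁻¹)ᴴ * signMatrix c d * (B * T * B⁻¹) = signMatrix c d
  rw [conjTranspose_mul, conjTranspose_mul, conjTranspose_nonsing_inv]
  calc _ = (Bᴴ)⁻¹ * (Tᴴ * (Bᴴ * signMatrix c d * B) * T) * B⁻¹ := by simp only [Matrix.mul_assoc]
    _ = _ := by
      rw [← h, hT', h, Matrix.mul_assoc Bᴴ, nonsing_inv_mul_cancel_left _ _ hB',
        mul_nonsing_inv_cancel_right _ _ hB]

theorem blockRotation_mul_conjTranspose (θ : ℝ) :
    (blockRotation c d θ)ᴴ * blockRotation c d θ = 1 := by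
  have h : star (Complex.exp (2 * Real.pi * Complex.I * θ)) *
      Complex.exp (2 * Real.pi * Complex.I * θ) = 1 := by
    rw [Complex.star_def, ← Complex.normSq_eq_conj_mul_self, Complex.normSq_eq_norm_sq,
      show (2 * Real.pi * Complex.I * θ : ℂ) = ((2 * Real.pi * θ : ℝ) : ℂ) * Complex.I by
        push_cast; ring, Complex.norm_exp_ofReal_mul_I]
    simp
  rw [blockRotation, fromBlocks_conjTranspose, fromBlocks_multiply, ← fromBlocks_one]
  congr 1 <;> simp [smul_smul]
  rw [mul_comm, ← Complex.star_def, h, one_smul]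

theorem blockRotation_mem (θ : ℝ) : blockRotation c d θ ∈ formGroup (signMatrix c d) := by
  have h := blockRotation_mul_conjTranspose (c := c) (d := d) θ
  have hc : signMatrix c d * blockRotation c d θ = blockRotation c d θ * signMatrix c d := by
    simp [signMatrix, blockRotation, fromBlocks_multiply]
  change (blockRotation c d θ)ᴴ * signMatrix c d * blockRotation c d θ = signMatrix c d
  rw [Matrix.mul_assoc, hc, ← Matrix.mul_assoc, h, Matrix.one_mul]

theorem mul_mem_formGroup {ι : Type*} [Fintype ι] [DecidableEq ι] {𝒢 S T : Matrix ι ι ℂ}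
    (hS : S ∈ formGroup 𝒢) (hT : T ∈ formGroup 𝒢) : S * T ∈ formGroup 𝒢 := by
  have hS' : Sᴴ * 𝒢 * S = 𝒢 := hS
  have hT' : Tᴴ * 𝒢 * T = 𝒢 := hT
  change (S * T)ᴴ * 𝒢 * (S * T) = 𝒢
  calc _ = Tᴴ * (Sᴴ * 𝒢 * S) * T := by rw [conjTranspose_mul]; simp only [Matrix.mul_assoc]
    _ = 𝒢 := by rw [hS', hT']

theorem norm_det_of_mem {T : Matrix (Fin c ⊕ Fin d) (Fin c ⊕ Fin d) ℂ}
    (hT : T ∈ formGroup (signMatrix c d)) : ‖T.det‖ = 1 := by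
  have hT' : Tᴴ * signMatrix c d * T = signMatrix c d := hT
  have h0 : (signMatrix c d).det ≠ 0 := by
    intro h
    have := congrArg det (signMatrix_mul_self (c := c) (d := d))
    rw [det_mul, h, det_one, mul_zero] at this
    exact zero_ne_one this
  have h := congrArg (fun M => ‖det M‖) hT'
  simp only [det_mul, det_conjTranspose, norm_mul, norm_star] at h
  have hp : 0 < ‖(signMatrix c d).det‖ := norm_pos_iff.2 h0
  have h2 : ‖T.det‖ ^ 2 = 1 := by
    refine mul_right_cancel₀ hp.ne' ?_
    rw [one_mul]; linarith
  exact (pow_eq_one_iff_of_nonneg (norm_nonneg _) two_ne_zero).1 h2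

variable {X : Type*} {f : X → X}

theorem cocycleIterate_mem {ι : Type*} [Fintype ι] [DecidableEq ι] {𝒢 : Matrix ι ι ℂ}
    {C : X → Matrix ι ι ℂ} (hC : ∀ x, C x ∈ formGroup 𝒢) (n : ℕ) (x : X) :
    cocycleIterate f C n x ∈ formGroup 𝒢 := by
  induction n with
  | zero => simp [cocycleIterate, formGroup]
  | succ n ih => exact mul_mem_formGroup (hC _) ih

theorem cocycleIterate_conj {ι : Type*} [Fintype ι] [DecidableEq ι] {B : Matrix ι ι ℂ}
    (hB : IsUnit B.det) (C : X → Matrix ι ι ℂ) (n : ℕ) (x : X) :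
    cocycleIterate f (fun x => B * C x * B⁻¹) n x = B * cocycleIterate f C n x * B⁻¹ := by
  induction n with
  | zero => rw [cocycleIterate, cocycleIterate, Matrix.mul_one, mul_nonsing_inv _ hB]
  | succ n ih =>
    rw [cocycleIterate, cocycleIterate, ih]
    calc _ = B * C (f^[n] x) * (B⁻¹ * B) * cocycleIterate f C n x * B⁻¹ := by
          simp only [Matrix.mul_assoc]
      _ = _ := by rw [nonsing_inv_mul _ hB, Matrix.mul_one]; simp only [Matrix.mul_assoc]

variable {M : X → Matrix (Fin c ⊕ Fin d) (Fin c ⊕ Fin d) ℂ}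

/-- `ln |det D_n|`, where `D_n` is the lower right block of the `n`-th iterate of `U_θ M`. -/
noncomputable def logBlockDet (f : X → X) (M : X → Matrix (Fin c ⊕ Fin d) (Fin c ⊕ Fin d) ℂ)
    (n : ℕ) (θ : ℝ) (x : X) : ℝ :=
  Real.log ‖(cocycleIterate f (fun x => blockRotation c d θ * M x) n x).toBlocks₂₂.det‖

theorem rotated_mem (hM : ∀ x, M x ∈ formGroup (signMatrix c d)) (θ : ℝ) (x : X) :
    blockRotation c d θ * M x ∈ formGroup (signMatrix c d) :=
  mul_mem_formGroup (blockRotation_mem θ) (hM x)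

theorem logBlockDet_eq (hM : ∀ x, M x ∈ formGroup (signMatrix c d)) (n : ℕ) (θ : ℝ) (x : X) :
    logBlockDet f M n θ x =
      logCoshSum d (cocycleIterate f (fun x => blockRotation c d θ * M x) n x) :=
  (logCoshSum_eq_log_norm_det (cocycleIterate_mem (rotated_mem hM θ) n x)).symm

theorem le_card_of_le {k : ℕ} (hk : k ≤ d) : k ≤ Fintype.card (Fin c ⊕ Fin d) := by
  simp only [Fintype.card_sum, Fintype.card_fin]; omega

theorem logBlockDet_nonneg (hM : ∀ x, M x ∈ formGroup (signMatrix c d)) (n : ℕ) (θ : ℝ) (x : X) :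
    0 ≤ logBlockDet f M n θ x := by
  rw [logBlockDet_eq hM]
  exact logCoshSum_nonneg (cocycleIterate_mem (rotated_mem hM θ) n x)

theorem logBlockDet_le (hM : ∀ x, M x ∈ formGroup (signMatrix c d)) (n : ℕ) (θ : ℝ) (x : X) :
    logBlockDet f M n θ x ≤ ∑ j ∈ Finset.range n, logProd d (M (f^[j] x)) := by
  rw [logBlockDet_eq hM]
  refine (logCoshSum_le (cocycleIterate_mem (rotated_mem hM θ) n x)).trans ?_
  refine (logProd_cocycleIterate_le (fun x => norm_det_of_mem (rotated_mem hM θ x))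
    (le_card_of_le le_rfl) n x).trans (Finset.sum_le_sum fun j _ => ?_)
  have := logProd_mul_le (isUnit_det_of_mem (blockRotation_mem (c := c) (d := d) θ))
    (isUnit_det_of_mem (hM (f^[j] x))) (le_card_of_le (c := c) (le_refl d))
  rwa [logProd_of_unitary (blockRotation_mul_conjTranspose θ) (le_card_of_le le_rfl),
    zero_add] at this

variable [MeasurableSpace X] {μ : Measure X}

theorem measurable_logBlockDet (hf : Measurable f) (hM : ∀ i j, Measurable fun x => M x i j)
    (n : ℕ) : Measurable fun p : ℝ × X => logBlockDet f M n p.1 p.2 := by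
  have h : ∀ i j, Measurable fun p : ℝ × X =>
      cocycleIterate f (fun x => blockRotation c d p.1 * M x) n p.2 i j := by
    induction n with
    | zero => exact fun _ _ => measurable_const
    | succ n ih =>
      have hb : ∀ i j, Measurable fun p : ℝ × X => blockRotation c d p.1 i j := by
        rintro (i | i) (j | j) <;> simp only [blockRotation, fromBlocks_apply₁₁, fromBlocks_apply₁₂,
          fromBlocks_apply₂₁, fromBlocks_apply₂₂, Matrix.smul_apply, smul_eq_mul, Matrix.zero_apply]
        · fun_prop
        all_goals exact measurable_const
      have hm : ∀ i j, Measurable fun p : ℝ × X => M (f^[n] p.2) i j := fun i j =>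
        (hM i j).comp ((hf.iterate n).comp measurable_snd)
      intro i j
      simp only [cocycleIterate, mul_apply]
      fun_prop
  unfold logBlockDet
  simp only [det_apply, toBlocks₂₂, of_apply]
  fun_prop

theorem integrable_logBlockDet (hf : MeasurePreserving f μ μ)
    (hmeas : ∀ i j, Measurable fun x => M x i j) (hM : ∀ x, M x ∈ formGroup (signMatrix c d))
    (hint : Integrable (fun x => logProd d (M x)) μ) (n : ℕ) (θ : ℝ) :
    Integrable (logBlockDet f M n θ) μ := by
  have h1 : Integrable (fun x => ∑ j ∈ Finset.range n, logProd d (M (f^[j] x))) μ :=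
    integrable_finsetSum _ fun j _ => integrable_comp_iterate hf hint j
  refine Integrable.mono' h1
    ((measurable_logBlockDet hf.measurable hmeas n).comp
      measurable_prodMk_left).aestronglyMeasurable (ae_of_all _ fun x => ?_)
  rw [Real.norm_of_nonneg (logBlockDet_nonneg hM n _ _)]
  exact logBlockDet_le hM n _ _

theorem integrable_logCoshSum (hmeas : ∀ i j, Measurable fun x => M x i j)
    (hM : ∀ x, M x ∈ formGroup (signMatrix c d))
    (hint : Integrable (fun x => logProd d (M x)) μ) :
    Integrable (fun x => logCoshSum d (M x)) μ := by
  refine Integrable.mono' hint (Measurable.aestronglyMeasurable ?_) (ae_of_all _ fun x => ?_)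
  · simp only [fun x => logCoshSum_eq_log_norm_det (hM x), det_apply, toBlocks₂₂, of_apply]
    fun_prop
  · rw [Real.norm_of_nonneg (logCoshSum_nonneg (hM x))]
    exact logCoshSum_le (hM x)

/-- A bound uniform in n and θ, which supplies the constant dominating function on [0, 1]. -/
theorem mean_logBlockDet_mem_Icc (hf : MeasurePreserving f μ μ)
    (hmeas : ∀ i j, Measurable fun x => M x i j) (hM : ∀ x, M x ∈ formGroup (signMatrix c d))
    (hint : Integrable (fun x => logProd d (M x)) μ) (n : ℕ) (θ : ℝ) :
    (1 / (n : ℝ)) * ∫ x, logBlockDet f M n θ x ∂μ ∈ Set.Icc 0 (∫ x, logProd d (M x) ∂μ) := by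
  have hn : (0 : ℝ) ≤ 1 / n := by positivity
  refine ⟨mul_nonneg hn (integral_nonneg fun x => logBlockDet_nonneg hM n θ x), ?_⟩
  have h1 : ∫ x, logBlockDet f M n θ x ∂μ ≤ n * ∫ x, logProd d (M x) ∂μ := by
    calc _ ≤ ∫ x, ∑ j ∈ Finset.range n, logProd d (M (f^[j] x)) ∂μ :=
          integral_mono (integrable_logBlockDet hf hmeas hM hint n θ)
            (integrable_finsetSum _ fun j _ => integrable_comp_iterate hf hint j)
            fun x => logBlockDet_le hM n θ x
      _ = _ := by
          rw [integral_finsetSum _ fun j _ => integrable_comp_iterate hf hint j]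
          simp only [integral_comp_iterate hf hint]
          simp
  -- For n = 0 the mean is 0 because 1 / 0 = 0, and only nonnegativity of the upper bound is needed.
  rcases eq_or_ne n 0 with rfl | h0
  · simpa using integral_nonneg fun x =>
      logProd_nonneg (norm_det_of_mem (hM x)) (le_card_of_le (c := c) (le_refl d))
  · have : (n : ℝ) ≠ 0 := by exact_mod_cast h0
    calc _ ≤ (1 / (n : ℝ)) * (n * ∫ x, logProd d (M x) ∂μ) := mul_le_mul_of_nonneg_left h1 hn
      _ = _ := by field_simp

variable [IsProbabilityMeasure μ]

theorem integrable_logBlockDet_prod (hf : MeasurePreserving f μ μ)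
    (hmeas : ∀ i j, Measurable fun x => M x i j) (hM : ∀ x, M x ∈ formGroup (signMatrix c d))
    (hint : Integrable (fun x => logProd d (M x)) μ) (n : ℕ) (ν : Measure ℝ) [IsFiniteMeasure ν] :
    Integrable (Function.uncurry (logBlockDet f M n)) (ν.prod μ) := by
  have h1 : Integrable (fun x => ∑ j ∈ Finset.range n, logProd d (M (f^[j] x))) μ :=
    integrable_finsetSum _ fun j _ => integrable_comp_iterate hf hint j
  refine Integrable.mono' (h1.comp_snd ν)
    (measurable_logBlockDet hf.measurable hmeas n).aestronglyMeasurable (ae_of_all _ fun p => ?_)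
  simp only [Function.uncurry]
  rw [Real.norm_of_nonneg (logBlockDet_nonneg hM n _ _)]
  exact logBlockDet_le hM n _ _

/-- Exact for each n ≥ 1, before any limit: Fubini, the mean value formula in θ for fixed x, then
invariance of μ for each of the n summands. -/
theorem integral_mean_logBlockDet (hf : MeasurePreserving f μ μ)
    (hmeas : ∀ i j, Measurable fun x => M x i j) (hM : ∀ x, M x ∈ formGroup (signMatrix c d))
    (hint : Integrable (fun x => logProd d (M x)) μ) {n : ℕ} (hn : n ≠ 0) :
    ∫ θ in (0 : ℝ)..1, (1 / (n : ℝ)) * ∫ x, logBlockDet f M n θ x ∂μ =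
      ∫ x, logCoshSum d (M x) ∂μ := by
  have : IsFiniteMeasure (volume.restrict (Set.uIoc (0 : ℝ) 1)) :=
    ⟨by rw [Measure.restrict_apply_univ, Set.uIoc_of_le zero_le_one]; simp⟩
  rw [intervalIntegral.integral_const_mul,
    intervalIntegral_integral_swap (integrable_logBlockDet_prod hf hmeas hM hint n (volume.restrict (Set.uIoc 0 1)))]
  simp only [logBlockDet, integral_log_norm_det_cocycleIterate hM]
  have hi := integrable_logCoshSum hmeas hM hint
  rw [integral_finsetSum _ fun j _ => integrable_comp_iterate hf hi j]
  simp only [integral_comp_iterate hf hi]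
  have : (n : ℝ) ≠ 0 := by exact_mod_cast hn
  simp
  field_simp

/-- The averaged exponent formula for any function that is the limit of the normalized integrals
of `ln |det D_n|`. -/
theorem integral_of_tendsto_mean_logBlockDet (hf : MeasurePreserving f μ μ)
    (hmeas : ∀ i j, Measurable fun x => M x i j) (hM : ∀ x, M x ∈ formGroup (signMatrix c d))
    (hint : Integrable (fun x => logProd d (M x)) μ) {Λ : ℝ → ℝ}
    (hΛ : ∀ θ, Tendsto (fun n : ℕ => (1 / (n : ℝ)) * ∫ x, logBlockDet f M n θ x ∂μ) atTop
      (𝓝 (Λ θ))) :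
    IntervalIntegrable Λ volume 0 1 ∧
      ∫ θ in (0 : ℝ)..1, Λ θ = ∫ x, logCoshSum d (M x) ∂μ := by
  have hm : ∀ n : ℕ, StronglyMeasurable fun θ => (1 / (n : ℝ)) * ∫ x, logBlockDet f M n θ x ∂μ :=
    fun n => (StronglyMeasurable.integral_prod_right (f := logBlockDet f M n)
      (measurable_logBlockDet hf.measurable hmeas n).stronglyMeasurable).const_mul _
  have hb := mean_logBlockDet_mem_Icc hf hmeas hM hint
  -- Convergence at every real θ makes Λ a pointwise limit of measurable functions.
  have hΛm : StronglyMeasurable Λ := stronglyMeasurable_of_tendsto atTop hm (tendsto_pi_nhds.2 hΛ)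
  have hc : IntervalIntegrable (fun _ => ∫ x, logProd d (M x) ∂μ) volume (0 : ℝ) 1 :=
    intervalIntegrable_const
  constructor
  · refine hc.mono_fun hΛm.aestronglyMeasurable (ae_of_all _ fun θ => ?_)
    have hmem := isClosed_Icc.mem_of_tendsto (hΛ θ) (Eventually.of_forall fun n => hb n θ)
    dsimp only
    rw [Real.norm_of_nonneg hmem.1]
    exact hmem.2.trans (le_abs_self _)
  · have h1 := intervalIntegral.tendsto_integral_filter_of_dominated_convergence
      (μ := volume) (a := 0) (b := 1) (l := atTop)
      (F := fun (n : ℕ) θ => (1 / (n : ℝ)) * ∫ x, logBlockDet f M n θ x ∂μ) (f := Λ)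
      (fun _ => ∫ x, logProd d (M x) ∂μ)
      (Eventually.of_forall fun n => (hm n).aestronglyMeasurable)
      (Eventually.of_forall fun n => ae_of_all _ fun θ _ => by
        rw [Real.norm_of_nonneg (hb n θ).1]; exact (hb n θ).2)
      hc (ae_of_all _ fun θ _ => hΛ θ)
    -- The converging integrals are eventually constant, equal to the integral of N_d.
    refine tendsto_nhds_unique h1 (tendsto_const_nhds.congr' ?_)
    filter_upwards [eventually_ne_atTop 0] with n hn
    exact (integral_mean_logBlockDet hf hmeas hM hint hn).symm

theorem tendsto_mean_of_abs_sub_le {g h : ℕ → X → ℝ} (hg : ∀ n, Integrable (g n) μ)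
    (hh : ∀ n, Integrable (h n) μ) {K L : ℝ} (hK : ∀ n x, |g n x - h n x| ≤ K)
    (hL : Tendsto (fun n : ℕ => (1 / (n : ℝ)) * ∫ x, h n x ∂μ) atTop (𝓝 L)) :
    Tendsto (fun n : ℕ => (1 / (n : ℝ)) * ∫ x, g n x ∂μ) atTop (𝓝 L) := by
  have h1 : Tendsto (fun n : ℕ => (1 / (n : ℝ)) * ∫ x, g n x ∂μ - (1 / (n : ℝ)) * ∫ x, h n x ∂μ)
      atTop (𝓝 0) := by
    have h0 : Tendsto (fun n : ℕ => (1 / (n : ℝ)) * K) atTop (𝓝 0) := by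
      simpa using tendsto_one_div_atTop_nhds_zero_nat.mul_const K
    refine squeeze_zero_norm (fun n => ?_) h0
    rw [← mul_sub, ← integral_sub (hg n) (hh n), norm_mul, Real.norm_of_nonneg (by positivity)]
    refine mul_le_mul_of_nonneg_left ?_ (by positivity)
    have := norm_integral_le_of_norm_le_const (μ := μ) (f := fun x => g n x - h n x) (C := K)
      (ae_of_all _ fun x => hK n x)
    simpa using this
  simpa using h1.add hL

end MainTheorem

end HermitianCocycle

/-! ### The averaged Lyapunov exponent formula -/

theorem mainTheorem5 (c d : ℕ) (𝒢 : Matrix (Fin c ⊕ Fin d) (Fin c ⊕ Fin d) ℂ)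
    (h𝒢 : IsUnit 𝒢) (hsig : HasSignature 𝒢 c d) :
    ∃ B : Matrix (Fin c ⊕ Fin d) (Fin c ⊕ Fin d) ℂ, IsUnit B ∧
      ∀ (X : Type*) [MeasurableSpace X] (μ : Measure X) [IsProbabilityMeasure μ]
        (f : X → X) (_ : MeasurePreserving f μ μ)
        (A : X → Matrix (Fin c ⊕ Fin d) (Fin c ⊕ Fin d) ℂ)
        (_ : LogIntegrable μ (formGroup 𝒢) A),
        (∀ θ ∈ Set.Icc (0 : ℝ) 1, ∀ k < d,
          LyapunovExponentExists μ f (fun x => B⁻¹ * blockRotation c d θ * B * A x) k) ∧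
        IntervalIntegrable
          (fun θ => lyapunovSum μ f (fun x => B⁻¹ * blockRotation c d θ * B * A x) d) volume 0 1 ∧
        Integrable (fun x => logCoshSum d (B * A x * B⁻¹)) μ ∧
        ∫ θ in (0 : ℝ)..1, lyapunovSum μ f (fun x => B⁻¹ * blockRotation c d θ * B * A x) d =
          ∫ x, logCoshSum d (B * A x * B⁻¹) ∂μ := by
  obtain ⟨B, hB, h⟩ := exists_conjTranspose_mul_signMatrix_mul h𝒢 hsig
  refine ⟨B, (isUnit_iff_isUnit_det _).2 hB, fun X _ μ _ f hf A hA => ?_⟩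
  have hB' : IsUnit (B⁻¹).det := isUnit_nonsing_inv_det _ hB
  have hM : ∀ x, B * A x * B⁻¹ ∈ formGroup (signMatrix c d) := fun x =>
    conj_mem_formGroup hB h (hA.mem x)
  have conj_det : ∀ T, (B * T * B⁻¹).det = T.det := fun T => by
    rw [det_mul_right_comm, mul_nonsing_inv _ hB, Matrix.one_mul]
  have hAdet : ∀ x, ‖(A x).det‖ = 1 := fun x => by rw [← conj_det, norm_det_of_mem (hM x)]
  have hAu := fun x => isUnit_det_of_norm_eq_one (hAdet x)
  have hAint : ∀ k ≤ Fintype.card (Fin c ⊕ Fin d), Integrable (fun x => logProd k (A x)) μ := by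
    intro k hk
    refine Integrable.mono' (hA.integrable_log_norm.const_mul (k : ℝ))
      (measurable_logProd hA.measurable hAu hk).aestronglyMeasurable (ae_of_all _ fun x => ?_)
    rw [Real.norm_of_nonneg (logProd_nonneg (hAdet x) hk)]
    exact logProd_le_log_norm (hAu x) hk
  have hMmeas : ∀ i j, Measurable fun x => (B * A x * B⁻¹) i j := by
    have := hA.measurable
    intro i j
    simp only [mul_apply]
    fun_prop
  have hMint : Integrable (fun x => logProd d (B * A x * B⁻¹)) μ := by
    have hd : d ≤ Fintype.card (Fin c ⊕ Fin d) := le_card_of_le le_rfl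
    refine Integrable.mono' ((hAint d hd).add (integrable_const (logProd d B + logProd d B⁻¹)))
      (measurable_logProd hMmeas (fun x => isUnit_det_of_mem (hM x)) hd).aestronglyMeasurable
      (ae_of_all _ fun x => ?_)
    rw [Real.norm_of_nonneg (logProd_nonneg (norm_det_of_mem (hM x)) hd)]
    have := (abs_le.1 (abs_logProd_conj_sub_le hB (hAu x) hd)).2
    simp only [Pi.add_apply]
    linarith
  -- Conjugation by B turns the given cocycle into the rotated cocycle of M = B A B⁻¹ in the
  -- standard group.
  have hCM : ∀ θ x, B * (B⁻¹ * blockRotation c d θ * B * A x) * B⁻¹ =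
      blockRotation c d θ * (B * A x * B⁻¹) := fun θ x => by
    simp only [← Matrix.mul_assoc]
    rw [mul_nonsing_inv _ hB, Matrix.one_mul]
  have hCdet : ∀ θ x, ‖(B⁻¹ * blockRotation c d θ * B * A x).det‖ = 1 := fun θ x => by
    rw [← conj_det, hCM, norm_det_of_mem (rotated_mem hM θ x)]
  have hCmeas : ∀ θ i j, Measurable fun x => (B⁻¹ * blockRotation c d θ * B * A x) i j := by
    have := hA.measurable
    intro θ i j
    simp only [Matrix.mul_apply (N := A _)]
    fun_prop
  have hCint : ∀ θ, ∀ k ≤ Fintype.card (Fin c ⊕ Fin d),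
      Integrable (fun x => logProd k (B⁻¹ * blockRotation c d θ * B * A x)) μ := by
    intro θ k hk
    have hu : IsUnit (B⁻¹ * blockRotation c d θ * B).det := by
      rw [det_mul, det_mul]
      exact (hB'.mul (isUnit_det_of_mem (blockRotation_mem θ))).mul hB
    refine Integrable.mono'
      ((integrable_const (logProd k (B⁻¹ * blockRotation c d θ * B))).add (hAint k hk))
      (measurable_logProd (hCmeas θ) (fun x => isUnit_det_of_norm_eq_one (hCdet θ x))
        hk).aestronglyMeasurable (ae_of_all _ fun x => ?_)
    rw [Real.norm_of_nonneg (logProd_nonneg (hCdet θ x) hk)]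
    exact logProd_mul_le hu (hAu x) hk
  have hex : ∀ θ, ∀ k < d,
      LyapunovExponentExists μ f (fun x => B⁻¹ * blockRotation c d θ * B * A x) k :=
    fun θ k hk => lyapunovExponentExists_of_integrable hf (hCmeas θ) (hCdet θ) (hCint θ)
      (by simp only [Fintype.card_sum, Fintype.card_fin]; omega)
  have hlim : ∀ θ, Tendsto (fun n : ℕ => (1 / (n : ℝ)) *
      ∫ x, logBlockDet f (fun x => B * A x * B⁻¹) n θ x ∂μ) atTop
      (𝓝 (lyapunovSum μ f (fun x => B⁻¹ * blockRotation c d θ * B * A x) d)) := by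
    intro θ
    have hd : d ≤ Fintype.card (Fin c ⊕ Fin d) := le_card_of_le le_rfl
    refine tendsto_mean_of_abs_sub_le (integrable_logBlockDet hf hMmeas hM hMint · θ)
      (integrable_logProd_cocycleIterate hf (hCmeas θ) (hCdet θ) hd (hCint θ d hd))
      -- The first term compares N_d with the sum of the ln σ_i; the rest is the cost of conjugating
      -- the n-th iterate by B.
      (K := d * Real.log 2 + (logProd d B + logProd d B⁻¹)) (fun n x => ?_)
      (tendsto_lyapunovSum (hex θ))
    have hmem := cocycleIterate_mem (f := f) (rotated_mem hM θ) n x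
    have h1 := logCoshSum_le hmem
    have h2 := le_logCoshSum hmem
    have h3 := abs_logProd_conj_sub_le (k := d) hB (isUnit_det_of_norm_eq_one
      (norm_det_cocycleIterate (f := f) (hCdet θ) n x)) hd
    rw [← cocycleIterate_conj hB] at h3
    simp only [hCM] at h3
    rw [logBlockDet_eq hM]
    change _ ≤ logProd d _ at h1
    change logProd d _ - _ ≤ _ at h2
    have hl2 : 0 ≤ d * Real.log 2 := by positivity
    rw [abs_le] at h3 ⊢
    constructor <;> linarith [h3.1, h3.2]
  obtain ⟨hi, he⟩ := integral_of_tendsto_mean_logBlockDet hf hMmeas hM hMint hlim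
  exact ⟨fun θ _ => hex θ, hi, integrable_logCoshSum hMmeas hM hMint, he⟩
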